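/- Let $d\ge 1$ and $T\ge 2$ be integers. In each round $t=1,\dots,T$ of the bandit PCA game the learner picks a (random) unit vector $w_t\in\mathbb{R}^d$, the environment picks a symmetric matrix $L_t\in\mathbb{R}^{d\times d}$ of spectral norm at most $1$, and the learner incurs and observes only the number $\ell_t=\langle w_tw_t^{\mathsf T},L_t\rangle=\operatorname{tr}(w_tw_t^{\mathsf T}L_t)$. The environment may be randomized and adaptive: $L_t$ may depend on the entire history except on the draw of $w_t$. The regret is $$\mathrm{regret}_T=\max_{\|u\|=1}\sum_{t=1}^T\mathbb{E}\,\langle w_tw_t^{\mathsf T}-uu^{\mathsf T},L_t\rangle .$$ Online mirror descent with dense sampling and learning rate $\eta>0$ is the following algorithm. Start with $W_1=I/d$. In round $t$ take an eigendecomposition $W_t=\sum_{i=1}^d\lambda_iu_iu_i^{\mathsf T}$ with orthonormal $u_i$ and flip a fair coin $B\in\{0,1\}$. If $B=1$, draw an index $I$ with $\mathbb{P}(I=i)=\lambda_i$, play $w_t=u_I$, observe $\ell_t$, and set $\widetilde L_t=2\ell_tW_t^{-1/2}w_tw_t^{\mathsf T}W_t^{-1/2}$. If $B=0$, draw independent uniform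 signs $s_1,\dots,s_d\in\{-1,1\}$, play $w_t=\sum_is_i\sqrt{\lambda_i}\,u_i$, observe $\ell_t$, and set $\widetilde L_t=\ell_t(W_t^{-1}w_tw_t^{\mathsf T}W_t^{-1}-W_t^{-1})$. Then set $W_{t+1}=(W_t^{-1}+\eta\widetilde L_t+\beta I)^{-1}$, where $\beta\in\mathbb{R}$ is such that the matrix being inverted is positive definite and $\operatorname{tr}W_{t+1}=1$. There is a universal constant $C>0$ such that the following holds for all such $d$, $T$ and every such environment. Suppose that every $L_t$ is positive semidefinite, that $\overline L_T^*$ is a real number with $$\overline L_T^*\ \ge\ \min_{\|u\|=1}\mathbb{E}\Big[\sum_{t=1}^T\operatorname{tr}(uu^{\mathsf T}L_t)\Big],$$ and that the algorithm is run with $$\eta=\min\Big\{\sqrt{\tfrac{\log T}{d\,\overline L_T^*}},\ \tfrac1{4d^2}\Big\},$$ where the first term is read as $+\infty$ if $\overline L_T^*=0$. Then $$\mathrm{regret}_T\ \le\ C\Big(d^{3/2}\sqrt{\overline L_T^*\log T}+d^3\log T\Big).$$ -/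

import Mathlib

open MeasureTheory ProbabilityTheory

noncomputable section

namespace BanditPCA

/-- The rank-one matrix `w wᵀ`. -/
def outer {d : ℕ} (w : EuclideanSpace ℝ (Fin d)) : Matrix (Fin d) (Fin d) ℝ :=
  Matrix.of fun i j => w i * w j

/-- The inner product `⟨A, B⟩ = tr (Aᵀ B)` of two matrices. -/
def frob {d : ℕ} (A B : Matrix (Fin d) (Fin d) ℝ) : ℝ := (A.transpose * B).trace

/-- A loss matrix: symmetric with spectral norm (Euclidean operator norm) at most `1`. -/
def IsLossMatrix {d : ℕ} (L : Matrix (Fin d) (Fin d) ℝ) : Prop :=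
  L.IsSymm ∧ ‖Matrix.toEuclideanCLM (n := Fin d) (𝕜 := ℝ) L‖ ≤ 1

/-- `W = ∑ i, lam i • u i (u i)ᵀ`, an eigendecomposition of `W` with orthonormal eigenvectors. -/
def IsEigendecomposition {d : ℕ} (W : Matrix (Fin d) (Fin d) ℝ) (lam : Fin d → ℝ)
    (u : OrthonormalBasis (Fin d) ℝ (EuclideanSpace ℝ (Fin d))) : Prop :=
  W = ∑ i, lam i • outer (u i)

/-- The matrix `W ^ (-1/2)`, computed from an eigendecomposition `(lam, u)` of `W`. -/
def invSqrt {d : ℕ} (lam : Fin d → ℝ)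
    (u : OrthonormalBasis (Fin d) ℝ (EuclideanSpace ℝ (Fin d))) : Matrix (Fin d) (Fin d) ℝ :=
  ∑ i, (Real.sqrt (lam i))⁻¹ • outer (u i)

/-- The outcome of the internal randomization of the dense sampling method in one round.
`Sum.inl i`: the coin shows `B = 1` and the index `I = i` is drawn.
`Sum.inr s`: the coin shows `B = 0` and the vector of signs `s` is drawn. -/
abbrev Draw (d : ℕ) : Type := Fin d ⊕ (Fin d → ℤˣ)

/-- The probability of an outcome: `B` is a fair coin; given `B = 1` the index is drawn from `lam`;
given `B = 0` the signs are independent and uniform. -/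
def drawProb {d : ℕ} (lam : Fin d → ℝ) : Draw d → ℝ
  | Sum.inl i => 1 / 2 * lam i
  | Sum.inr _ => 1 / 2 * (1 / 2) ^ d

/-- The vector that is played. -/
def action {d : ℕ} (lam : Fin d → ℝ)
    (u : OrthonormalBasis (Fin d) ℝ (EuclideanSpace ℝ (Fin d))) :
    Draw d → EuclideanSpace ℝ (Fin d)
  | Sum.inl i => u i
  | Sum.inr s => ∑ i, (((s i : ℤ) : ℝ) * Real.sqrt (lam i)) • u i

/-- The loss estimate of the dense sampling method, built from the observed real number `ell`,
the density matrix `W`, its eigendecomposition `(lam, u)` and the outcome of the draw. -/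
def lossEstimate {d : ℕ} (W : Matrix (Fin d) (Fin d) ℝ) (lam : Fin d → ℝ)
    (u : OrthonormalBasis (Fin d) ℝ (EuclideanSpace ℝ (Fin d))) (ell : ℝ) :
    Draw d → Matrix (Fin d) (Fin d) ℝ
  | Sum.inl i =>
      (2 * ell) • (invSqrt lam u * outer (action lam u (Sum.inl i)) * invSqrt lam u)
  | Sum.inr s => ell • (W⁻¹ * outer (action lam u (Sum.inr s)) * W⁻¹ - W⁻¹)

/-- The update `W' = (W⁻¹ + η Lest + β I)⁻¹`, with `β` such that `W'` is a density matrix: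
the matrix that is inverted is positive definite and `tr W' = 1`. -/
def IsUpdate {d : ℕ} (η : ℝ) (W Lest W' : Matrix (Fin d) (Fin d) ℝ) : Prop :=
  ∃ β : ℝ, (W⁻¹ + η • Lest + β • (1 : Matrix (Fin d) (Fin d) ℝ)).PosDef ∧
    W' = (W⁻¹ + η • Lest + β • (1 : Matrix (Fin d) (Fin d) ℝ))⁻¹ ∧ W'.trace = 1

/-- `T` rounds (numbered `0, …, T - 1`) of online mirror descent with learning rate `η`, dense
sampling and no additional exploration, played against an adaptive, possibly randomized
environment that chooses the matrices `L t`.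

`ℱ t` is the information that is available in round `t` before the draw of the learner: it contains
the past and the choice of `L t`, but not the draw `D t`. In round `t` the learner holds the density
matrix `W t`, takes some eigendecomposition `(lam t, u t)` of it and makes the draw `D t`. -/
structure IsDenseRun {Ω : Type*} {mΩ : MeasurableSpace Ω} {d : ℕ} (η : ℝ) (T : ℕ)
    (μ : Measure Ω) (ℱ : Filtration ℕ mΩ)
    (L W : ℕ → Ω → Matrix (Fin d) (Fin d) ℝ) (lam : ℕ → Ω → Fin d → ℝ)
    (u : ℕ → Ω → OrthonormalBasis (Fin d) ℝ (EuclideanSpace ℝ (Fin d)))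
    (D : ℕ → Ω → Draw d) : Prop where
  measurable_loss : ∀ t < T, ∀ i j, Measurable[ℱ t] fun ω => L t ω i j
  measurable_eigenvalues : ∀ t < T, ∀ i, Measurable[ℱ t] fun ω => lam t ω i
  measurable_eigenvectors : ∀ t < T, ∀ i j, Measurable[ℱ t] fun ω => u t ω i j
  measurable_draw : ∀ t < T, ∀ o, MeasurableSet[ℱ (t + 1)] (D t ⁻¹' {o})
  init : ∀ ω, W 0 ω = (1 / (d : ℝ)) • (1 : Matrix (Fin d) (Fin d) ℝ)
  eigendecomposition : ∀ t < T, ∀ ω, IsEigendecomposition (W t ω) (lam t ω) (u t ω)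
  /-- Conditionally on `ℱ t`, the draw has the prescribed law. -/
  draw_law : ∀ t < T, ∀ o, μ⟦D t ⁻¹' {o} | ℱ t⟧ =ᵐ[μ] fun ω => drawProb (lam t ω) o
  update : ∀ t < T, ∀ ω, IsUpdate η (W t ω)
    (lossEstimate (W t ω) (lam t ω) (u t ω)
      (frob (outer (action (lam t ω) (u t ω) (D t ω))) (L t ω)) (D t ω))
    (W (t + 1) ω)

/-- The difference between the expected cumulative losses of the played vectors `w` and of the fixed
vector `v`: `∑ t, E ⟨w_t w_tᵀ - v vᵀ, L_t⟩`. -/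
def regretAgainst {Ω : Type*} {mΩ : MeasurableSpace Ω} {d : ℕ} (T : ℕ) (μ : Measure Ω)
    (L : ℕ → Ω → Matrix (Fin d) (Fin d) ℝ) (w : ℕ → Ω → EuclideanSpace ℝ (Fin d))
    (v : EuclideanSpace ℝ (Fin d)) : ℝ :=
  ∑ t ∈ Finset.range T, ∫ ω, frob (outer (w t ω) - outer v) (L t ω) ∂μ

/-- The total expected regret: the largest regret against a fixed unit vector. -/
def regret {Ω : Type*} {mΩ : MeasurableSpace Ω} {d : ℕ} (T : ℕ) (μ : Measure Ω)
    (L : ℕ → Ω → Matrix (Fin d) (Fin d) ℝ) (w : ℕ → Ω → EuclideanSpace ℝ (Fin d)) : ℝ :=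
  ⨆ v : Metric.sphere (0 : EuclideanSpace ℝ (Fin d)) 1, regretAgainst T μ L w v

/-- The expected cumulative loss of the best fixed unit vector. -/
def bestLoss {Ω : Type*} {mΩ : MeasurableSpace Ω} {d : ℕ} (T : ℕ) (μ : Measure Ω)
    (L : ℕ → Ω → Matrix (Fin d) (Fin d) ℝ) : ℝ :=
  ⨅ v : Metric.sphere (0 : EuclideanSpace ℝ (Fin d)) 1,
    ∫ ω, ∑ t ∈ Finset.range T, frob (outer (v : EuclideanSpace ℝ (Fin d))) (L t ω) ∂μ

/-- The learning rate `min {√(log T / (d Lbar)), 1 / (4 d²)}`; for `Lbar = 0` the first term is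
infinite, so that the minimum is the second one. -/
def tunedRate (d T : ℕ) (Lbar : ℝ) : ℝ :=
  if Lbar = 0 then 1 / (4 * (d : ℝ) ^ 2)
  else min (Real.sqrt (Real.log T / (d * Lbar))) (1 / (4 * (d : ℝ) ^ 2))

end BanditPCA

end

/-! The algorithm is mirror descent with regularizer `-log det`, and the proof is a first-order
(small-loss) analysis of it. Fix a unit `v` and take as comparator `U` the projection on `v` mixed
with `I/d` at weight `1/T`. The potential `tr(W⁻¹U) - log det W⁻¹` equals `d - d log d` at `I/d` and
is never below `d + log det U`, so its total decrease is at most `d log T`.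

One round decreases it by at least `η(tr(W L̃) - tr(U L̃)) - 2η²d²ℓ`. The normalization `β` drops
out because `tr U = 1` and `log det` is concave. In the coordinates where `W` becomes `I`, the
estimate is a rank-one matrix (minus a multiple of `I` for dense draws), so the determinant is
explicit and the second-order error is of order `η²d²ℓ²`, hence `η²d²ℓ` as `0 ≤ ℓ ≤ 1`
(`coreEstimate_log_det`).

The estimates are unbiased (`sum_drawProb_lossEstimate`). Taking expectations, with `E` the
learner's expected loss and `L(v)` that of `v`, gives `E - L(v) ≤ 1 + d log T / η + 2ηd²E`
(`IsDenseRun.mul_regret_le`, after division by `η`). As `ηd² ≤ 1/4`, the term in `E` on the right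
can be absorbed, which bounds `E` through the best loss (`IsDenseRun.regret_le`). The tuned `η`
balances `ηd²L̄` against `d log T / η`, both of size `d^{3/2}√(L̄ log T)`; the cap `1/(4d²)`
produces the `d³ log T` term. -/

noncomputable section

namespace BanditPCA

open Matrix

/-! ### Concavity of `log det` and the effect of the trace normalization. -/

section LogDet

variable {n : Type*} [Fintype n] [DecidableEq n]

open scoped MatrixOrder in
/-- A positive definite real matrix is the square of an invertible symmetric matrix. -/
lemma exists_symm_sq_eq {A : Matrix n n ℝ} (hA : A.PosDef) :
    ∃ R : Matrix n n ℝ, Rᵀ = R ∧ R * R = A := by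
  have h0 : 0 ≤ A := Matrix.nonneg_iff_posSemidef.2 hA.posSemidef
  refine ⟨CFC.sqrt A, ?_, CFC.sqrt_mul_sqrt_self A h0⟩
  have := (Matrix.nonneg_iff_posSemidef.1 (CFC.sqrt_nonneg A)).isHermitian
  simpa [Matrix.IsHermitian, Matrix.conjTranspose_eq_transpose_of_trivial] using this

lemma log_det_le_trace_sub_card {C : Matrix n n ℝ} (hC : C.PosDef) :
    Real.log C.det ≤ C.trace - Fintype.card n := by
  have hpos := hC.eigenvalues_pos
  rw [hC.1.det_eq_prod_eigenvalues, hC.1.trace_eq_sum_eigenvalues]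
  simp only [RCLike.ofReal_real_eq_id, id]
  rw [Real.log_prod (fun i _ => (hpos i).ne')]
  calc ∑ i, Real.log (hC.1.eigenvalues i) ≤ ∑ i, (hC.1.eigenvalues i - 1) :=
        Finset.sum_le_sum fun i _ => Real.log_le_sub_one_of_pos (hpos i)
    _ = _ := by simp

/-- The witness is `A^{1/2} B A^{1/2}`: it turns the non-symmetric product `AB` into a positive
definite matrix with the same determinant and trace. -/
lemma exists_posDef_conj {A B : Matrix n n ℝ} (hA : A.PosDef) (hB : B.PosDef) :
    ∃ C : Matrix n n ℝ, C.PosDef ∧ C.det = A.det * B.det ∧ C.trace = (A * B).trace := by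
  obtain ⟨R, hR, hRA⟩ := exists_symm_sq_eq hA
  have hdet : R.det * R.det = A.det := by rw [← Matrix.det_mul, hRA]
  have hR0 : R.det ≠ 0 := by
    intro h
    have := hA.det_pos
    rw [← hdet, h] at this
    simp at this
  have hRu : IsUnit R := (Matrix.isUnit_iff_isUnit_det R).2 (isUnit_iff_ne_zero.2 hR0)
  refine ⟨R * B * R, ?_, ?_, ?_⟩
  · have := (Matrix.IsUnit.posDef_star_right_conjugate_iff (x := B) hRu).2 hB
    rwa [Matrix.star_eq_conjTranspose, Matrix.conjTranspose_eq_transpose_of_trivial, hR] at this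
  · rw [Matrix.det_mul, Matrix.det_mul, ← hdet]; ring
  · rw [Matrix.trace_mul_comm, ← Matrix.mul_assoc, hRA]

/-- Concavity of `log det`. -/
lemma log_det_le_log_det_add {A B : Matrix n n ℝ} (hA : A.PosDef) (hB : B.PosDef) :
    Real.log B.det ≤ Real.log A.det + (A⁻¹ * B).trace - Fintype.card n := by
  obtain ⟨C, hC, hdet, htr⟩ := exists_posDef_conj hA.inv hB
  have h := log_det_le_trace_sub_card hC
  have hA0 : A.det ≠ 0 := hA.det_pos.ne'
  rw [hdet, htr, Matrix.det_nonsing_inv, Ring.inverse_eq_inv',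
    Real.log_mul (inv_ne_zero hA0) hB.det_pos.ne', Real.log_inv] at h
  linarith

lemma trace_mul_nonneg {A B : Matrix n n ℝ} (hA : A.PosDef) (hB : B.PosDef) :
    0 ≤ (A * B).trace := by
  obtain ⟨C, hC, -, htr⟩ := exists_posDef_conj hA hB
  exact htr ▸ hC.posSemidef.trace_nonneg

/-- Normalizing the trace of the inverse by adding a multiple of the identity. -/
lemma log_det_le_of_trace_inv_eq_one {Q : Matrix n n ℝ} {β : ℝ} (hQ : Q.PosDef)
    (hP : (Q + β • (1 : Matrix n n ℝ)).PosDef)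
    (htr : (Q + β • (1 : Matrix n n ℝ))⁻¹.trace = 1) :
    Real.log Q.det + β ≤ Real.log (Q + β • (1 : Matrix n n ℝ)).det ∧ β ≤ Fintype.card n := by
  set P := Q + β • (1 : Matrix n n ℝ) with hPdef
  -- This trace serves both claims: inserted into the concavity inequality it leaves exactly `β`,
  -- and its nonnegativity is `β ≤ n`.
  have hPQ : (P⁻¹ * Q).trace = Fintype.card n - β := by
    have hQP : Q = P - β • (1 : Matrix n n ℝ) := by rw [hPdef]; abel
    have hu : IsUnit P.det := isUnit_iff_ne_zero.2 hP.det_pos.ne'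
    rw [hQP, Matrix.mul_sub, Matrix.nonsing_inv_mul _ hu, Matrix.mul_smul, Matrix.mul_one,
      Matrix.trace_sub, Matrix.trace_smul, htr, Matrix.trace_one]
    simp
  refine ⟨?_, ?_⟩
  · have := log_det_le_log_det_add hP hQ
    rw [hPQ] at this
    linarith
  · have := trace_mul_nonneg hP.inv hQ
    linarith

end LogDet

/-! ### Second and fourth moments of uniform random signs. -/

section Signs

lemma intUnit_cast_sq (x : ℤˣ) : (((x : ℤ) : ℝ)) * ((x : ℤ) : ℝ) = 1 := by
  rcases Int.units_eq_one_or x with h | h <;> simp [h]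

/-- A product of signs that changes its sign under some flip averages to zero. -/
lemma sum_signs_eq_zero {d : ℕ} (f : (Fin d → ℤˣ) → ℝ) (g : Fin d → ℤˣ)
    (h : ∀ s, f (s * g) = - f s) : ∑ s, f s = 0 := by
  have h1 : ∑ s, f (s * g) = ∑ s, f s := Fintype.sum_equiv (Equiv.mulRight g) _ _ fun s => rfl
  simp only [h, Finset.sum_neg_distrib] at h1
  linarith

/-- The real vector of a vector of signs. -/
def signVec {d : ℕ} (s : Fin d → ℤˣ) : Fin d → ℝ := fun i => ((s i : ℤ) : ℝ)

lemma signVec_mul_self {d : ℕ} (s : Fin d → ℤˣ) (i : Fin d) : signVec s i * signVec s i = 1 :=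
  intUnit_cast_sq (s i)

lemma signVec_mul_flip {d : ℕ} (s : Fin d → ℤˣ) (i j : Fin d) :
    signVec (s * Pi.mulSingle i (-1)) j = (if j = i then -1 else 1) * signVec s j := by
  by_cases h : j = i
  · subst h; simp [signVec]
  · simp [signVec, h]

lemma sum_signVec_mul {d : ℕ} (a b : Fin d) :
    ∑ s : Fin d → ℤˣ, signVec s a * signVec s b = if a = b then 2 ^ d else 0 := by
  split_ifs with h
  · subst h
    simp [signVec_mul_self]
  · refine sum_signs_eq_zero _ (Pi.mulSingle a (-1)) fun s => ?_
    rw [signVec_mul_flip, signVec_mul_flip, if_pos rfl, if_neg (Ne.symm h)]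
    ring

/-- The product is constantly 1 when the pairs coincide; otherwise some sign occurs an odd number of
times, and flipping it negates the summand. If exactly one of `j`, `k` is `a`, that sign is `s_b`;
if both or neither are, it is `s_a`. -/
lemma sum_signVec_mul_four {d : ℕ} (j k a b : Fin d) (hab : a ≠ b) :
    ∑ s : Fin d → ℤˣ, signVec s j * signVec s k * (signVec s a * signVec s b) =
      if (j = a ∧ k = b) ∨ (j = b ∧ k = a) then 2 ^ d else 0 := by
  split_ifs with h
  · have : ∀ s : Fin d → ℤˣ, signVec s j * signVec s k * (signVec s a * signVec s b) = 1 := by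
      intro s
      have ha := signVec_mul_self s a
      have hb := signVec_mul_self s b
      rcases h with ⟨rfl, rfl⟩ | ⟨rfl, rfl⟩
      · linear_combination ha * (signVec s k * signVec s k) + hb
      · linear_combination ha * (signVec s j * signVec s j) + hb
    simp [this]
  · by_cases hc : (j = a ∧ k ≠ a) ∨ (j ≠ a ∧ k = a)
    · refine sum_signs_eq_zero _ (Pi.mulSingle b (-1)) fun s => ?_
      simp only [signVec_mul_flip, if_neg hab, if_true]
      have hj : j ≠ b := by rintro rfl; rcases hc with hc | hc <;> grind
      have hk : k ≠ b := by rintro rfl; rcases hc with hc | hc <;> grind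
      rw [if_neg hj, if_neg hk]
      ring
    · refine sum_signs_eq_zero _ (Pi.mulSingle a (-1)) fun s => ?_
      simp only [signVec_mul_flip, if_neg hab.symm, if_true]
      by_cases hj : j = a
      · have hk : k = a := by by_contra hk; exact hc (Or.inl ⟨hj, hk⟩)
        simp only [hj, hk, if_true]; ring
      · have hk : k ≠ a := fun hk => hc (Or.inr ⟨hj, hk⟩)
        rw [if_neg hj, if_neg hk]; ring

lemma dotProduct_mulVec_eq_sum {d : ℕ} (N : Matrix (Fin d) (Fin d) ℝ) (x : Fin d → ℝ) :
    x ⬝ᵥ N *ᵥ x = ∑ j, ∑ k, N j k * (x j * x k) := by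
  simp only [dotProduct, mulVec, Finset.mul_sum]
  refine Finset.sum_congr rfl fun j _ => Finset.sum_congr rfl fun k _ => by ring

/-- Under uniform signs `s`, the quadratic form `sᵀ N s` has mean `tr N`. -/
lemma sum_signVec_quadratic {d : ℕ} (N : Matrix (Fin d) (Fin d) ℝ) :
    ∑ s : Fin d → ℤˣ, signVec s ⬝ᵥ N *ᵥ signVec s = 2 ^ d * N.trace := by
  simp only [dotProduct_mulVec_eq_sum]
  rw [Finset.sum_comm]
  simp_rw [Finset.sum_comm (s := (Finset.univ : Finset (Fin d → ℤˣ))), ← Finset.mul_sum,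
    sum_signVec_mul]
  simp [Matrix.trace, Finset.mul_sum, mul_comm]

/-- Under uniform signs `s`, the mean of `(sᵀ N s) s_a s_b` for `a ≠ b`. -/
lemma sum_signVec_quadratic_mul {d : ℕ} (N : Matrix (Fin d) (Fin d) ℝ) {a b : Fin d}
    (hab : a ≠ b) :
    ∑ s : Fin d → ℤˣ, (signVec s ⬝ᵥ N *ᵥ signVec s) * (signVec s a * signVec s b) =
      2 ^ d * (N a b + N b a) := by
  simp only [dotProduct_mulVec_eq_sum, Finset.sum_mul]
  have hpair : ∀ j k : Fin d, ∑ s : Fin d → ℤˣ,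
      N j k * (signVec s j * signVec s k) * (signVec s a * signVec s b) =
        N j k * if (j = a ∧ k = b) ∨ (j = b ∧ k = a) then (2 : ℝ) ^ d else 0 := by
    intro j k
    rw [← sum_signVec_mul_four j k a b hab, Finset.mul_sum]
    exact Finset.sum_congr rfl fun s _ => by ring
  rw [Finset.sum_comm]
  have hswap : ∀ j : Fin d, ∑ s : Fin d → ℤˣ, ∑ k,
      N j k * (signVec s j * signVec s k) * (signVec s a * signVec s b) =
        ∑ k, N j k * if (j = a ∧ k = b) ∨ (j = b ∧ k = a) then (2 : ℝ) ^ d else 0 := by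
    intro j
    rw [Finset.sum_comm]
    exact Finset.sum_congr rfl fun k _ => hpair j k
  rw [Finset.sum_congr rfl fun j _ => hswap j]
  -- The two alternatives exclude each other because `a ≠ b`, so the indicator of the disjunction is
  -- a sum of two indicators.
  have : ∀ j k : Fin d, (N j k * if (j = a ∧ k = b) ∨ (j = b ∧ k = a) then (2 : ℝ) ^ d else 0) =
      (if j = a then if k = b then N a b * 2 ^ d else 0 else 0) +
      (if j = b then if k = a then N b a * 2 ^ d else 0 else 0) := by
    intro j k
    by_cases h1 : j = a <;> by_cases h2 : k = b <;> by_cases h3 : j = b <;> by_cases h4 : k = a <;>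
      simp_all
  simp_rw [this, Finset.sum_add_distrib]
  simp
  ring

end Signs

/-! ### Factorizations `W = H Hᵀ`, `W⁻¹ = G Gᵀ` and the estimate in whitened coordinates. -/

section Factors

variable {d : ℕ}

lemma outer_eq_vecMulVec (w : EuclideanSpace ℝ (Fin d)) : outer w = vecMulVec w.ofLp w.ofLp := by
  ext i j; simp [outer, vecMulVec_apply]

lemma vecMulVec_mulVec_mulVec (A : Matrix (Fin d) (Fin d) ℝ) (x : Fin d → ℝ) :
    vecMulVec (A *ᵥ x) (A *ᵥ x) = A * vecMulVec x x * Aᵀ := by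
  rw [Matrix.mul_vecMulVec, Matrix.vecMulVec_mul, Matrix.vecMul_transpose]

/-- The orthogonal matrix whose columns are the basis vectors. -/
def basisMatrix (u : OrthonormalBasis (Fin d) ℝ (EuclideanSpace ℝ (Fin d))) :
    Matrix (Fin d) (Fin d) ℝ :=
  Matrix.of fun j i => u i j

lemma basisMatrix_transpose_mul (u : OrthonormalBasis (Fin d) ℝ (EuclideanSpace ℝ (Fin d))) :
    (basisMatrix u)ᵀ * basisMatrix u = 1 := by
  ext i j
  have h := orthonormal_iff_ite.1 u.orthonormal i j
  rw [PiLp.inner_apply] at h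
  simp only [basisMatrix, Matrix.mul_apply, Matrix.transpose_apply, Matrix.of_apply,
    Matrix.one_apply]
  rw [← h]
  exact Finset.sum_congr rfl fun k _ => by simp [mul_comm]

lemma basisMatrix_mul_transpose (u : OrthonormalBasis (Fin d) ℝ (EuclideanSpace ℝ (Fin d))) :
    basisMatrix u * (basisMatrix u)ᵀ = 1 :=
  mul_eq_one_comm.1 (basisMatrix_transpose_mul u)

lemma sum_smul_outer (c : Fin d → ℝ)
    (u : OrthonormalBasis (Fin d) ℝ (EuclideanSpace ℝ (Fin d))) :
    ∑ i, c i • outer (u i) = basisMatrix u * diagonal c * (basisMatrix u)ᵀ := by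
  ext a b
  rw [Matrix.mul_apply, Matrix.sum_apply]
  refine Finset.sum_congr rfl fun i _ => ?_
  simp [outer, basisMatrix, Matrix.mul_diagonal]
  ring

/-- The factor `H = O Λ ^ (1/2)` of `W = O Λ Oᵀ = H Hᵀ`. -/
def sqrtFactor (lam : Fin d → ℝ) (u : OrthonormalBasis (Fin d) ℝ (EuclideanSpace ℝ (Fin d))) :
    Matrix (Fin d) (Fin d) ℝ :=
  basisMatrix u * diagonal fun i => Real.sqrt (lam i)

/-- The factor `G = O Λ ^ (-1/2)` of `W⁻¹ = G Gᵀ`. -/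
def invSqrtFactor (lam : Fin d → ℝ)
    (u : OrthonormalBasis (Fin d) ℝ (EuclideanSpace ℝ (Fin d))) : Matrix (Fin d) (Fin d) ℝ :=
  basisMatrix u * diagonal fun i => (Real.sqrt (lam i))⁻¹

variable {W : Matrix (Fin d) (Fin d) ℝ} {lam : Fin d → ℝ}
  {u : OrthonormalBasis (Fin d) ℝ (EuclideanSpace ℝ (Fin d))}

lemma IsEigendecomposition.eq_basisMatrix (h : IsEigendecomposition W lam u) :
    W = basisMatrix u * diagonal lam * (basisMatrix u)ᵀ := by
  rw [← sum_smul_outer]; exact h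

lemma IsEigendecomposition.transpose_mul_mul (h : IsEigendecomposition W lam u) :
    (basisMatrix u)ᵀ * W * basisMatrix u = diagonal lam := by
  rw [h.eq_basisMatrix]
  calc (basisMatrix u)ᵀ * (basisMatrix u * diagonal lam * (basisMatrix u)ᵀ) * basisMatrix u
      = ((basisMatrix u)ᵀ * basisMatrix u) * diagonal lam * ((basisMatrix u)ᵀ * basisMatrix u) := by
        simp only [Matrix.mul_assoc]
    _ = diagonal lam := by rw [basisMatrix_transpose_mul]; simp

lemma IsEigendecomposition.eigenvalue_pos (h : IsEigendecomposition W lam u) (hW : W.PosDef)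
    (i : Fin d) : 0 < lam i := by
  have hu : IsUnit (basisMatrix u) :=
    IsUnit.of_mul_eq_one _ (basisMatrix_mul_transpose u)
  have := (Matrix.IsUnit.posDef_star_left_conjugate_iff (x := W) hu).2 hW
  rw [Matrix.star_eq_conjTranspose, Matrix.conjTranspose_eq_transpose_of_trivial,
    h.transpose_mul_mul] at this
  simpa using this.diag_pos (i := i)

lemma IsEigendecomposition.sum_eigenvalues (h : IsEigendecomposition W lam u) :
    ∑ i, lam i = W.trace := by
  rw [h.eq_basisMatrix, Matrix.trace_mul_comm, ← Matrix.mul_assoc, basisMatrix_transpose_mul,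
    Matrix.one_mul, Matrix.trace_diagonal]

lemma IsEigendecomposition.eq_sqrtFactor (h : IsEigendecomposition W lam u)
    (hlam : ∀ i, 0 < lam i) : W = sqrtFactor lam u * (sqrtFactor lam u)ᵀ := by
  rw [h.eq_basisMatrix, sqrtFactor, Matrix.transpose_mul, Matrix.diagonal_transpose]
  have : diagonal lam = diagonal (fun i => √(lam i)) * diagonal (fun i => √(lam i)) := by
    rw [Matrix.diagonal_mul_diagonal]
    congr 1
    ext i
    exact (Real.mul_self_sqrt (hlam i).le).symm
  rw [this]
  simp only [Matrix.mul_assoc]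

lemma diagonal_inv_sqrt_mul (hlam : ∀ i, 0 < lam i) :
    diagonal (fun i => (√(lam i))⁻¹) * diagonal (fun i => √(lam i)) = 1 := by
  rw [Matrix.diagonal_mul_diagonal, ← Matrix.diagonal_one]
  congr 1
  ext i
  exact inv_mul_cancel₀ (Real.sqrt_pos.2 (hlam i)).ne'

lemma invSqrtFactor_mul_sqrtFactor_transpose (hlam : ∀ i, 0 < lam i) :
    invSqrtFactor lam u * (sqrtFactor lam u)ᵀ = 1 := by
  rw [invSqrtFactor, sqrtFactor, Matrix.transpose_mul, Matrix.diagonal_transpose]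
  calc _ = basisMatrix u * (diagonal (fun i => (√(lam i))⁻¹) * diagonal (fun i => √(lam i))) *
        (basisMatrix u)ᵀ := by simp only [Matrix.mul_assoc]
    _ = 1 := by rw [diagonal_inv_sqrt_mul hlam, Matrix.mul_one, basisMatrix_mul_transpose]

lemma sqrtFactor_transpose_mul_invSqrtFactor (hlam : ∀ i, 0 < lam i) :
    (sqrtFactor lam u)ᵀ * invSqrtFactor lam u = 1 :=
  mul_eq_one_comm.1 (invSqrtFactor_mul_sqrtFactor_transpose hlam)

lemma invSqrtFactor_transpose_mul_sqrtFactor (hlam : ∀ i, 0 < lam i) :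
    (invSqrtFactor lam u)ᵀ * sqrtFactor lam u = 1 := by
  have := congrArg Matrix.transpose (sqrtFactor_transpose_mul_invSqrtFactor (u := u) hlam)
  simpa using this

lemma sqrtFactor_mul_invSqrtFactor_transpose (hlam : ∀ i, 0 < lam i) :
    sqrtFactor lam u * (invSqrtFactor lam u)ᵀ = 1 :=
  mul_eq_one_comm.1 (invSqrtFactor_transpose_mul_sqrtFactor hlam)

lemma IsEigendecomposition.inv_eq (h : IsEigendecomposition W lam u) (hlam : ∀ i, 0 < lam i) :
    W⁻¹ = invSqrtFactor lam u * (invSqrtFactor lam u)ᵀ := by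
  refine Matrix.inv_eq_right_inv ?_
  rw [h.eq_sqrtFactor hlam]
  calc _ = sqrtFactor lam u * ((sqrtFactor lam u)ᵀ * invSqrtFactor lam u) *
        (invSqrtFactor lam u)ᵀ := by simp only [Matrix.mul_assoc]
    _ = 1 := by
      rw [sqrtFactor_transpose_mul_invSqrtFactor hlam, Matrix.mul_one,
        sqrtFactor_mul_invSqrtFactor_transpose hlam]

lemma action_inl (i : Fin d) :
    (action lam u (Sum.inl i)).ofLp = basisMatrix u *ᵥ Pi.single i 1 := by
  ext j; simp [action, basisMatrix]

lemma action_inr (s : Fin d → ℤˣ) :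
    (action lam u (Sum.inr s)).ofLp = sqrtFactor lam u *ᵥ signVec s := by
  ext j
  simp only [action, sqrtFactor, basisMatrix, signVec, mulVec, dotProduct, Matrix.mul_diagonal]
  rw [WithLp.ofLp_sum, Finset.sum_apply]
  refine Finset.sum_congr rfl fun i _ => ?_
  simp
  ring

/-- The loss estimate in whitened coordinates. -/
def coreEstimate (ell : ℝ) : Draw d → Matrix (Fin d) (Fin d) ℝ
  | Sum.inl i => (2 * ell) • vecMulVec (Pi.single i 1) (Pi.single i 1)
  | Sum.inr s => ell • (vecMulVec (signVec s) (signVec s) - 1)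

/-- The dense action is `H s`, and `Gᵀ H = 1`, so conjugating by `W⁻¹ = G Gᵀ` leaves only the sign
vector. For an eigenvector draw, `W^{-1/2}` differs from `G` by the orthogonal matrix that sends the
drawn eigenvector to a coordinate vector. -/
lemma lossEstimate_eq (h : IsEigendecomposition W lam u) (hlam : ∀ i, 0 < lam i) (ell : ℝ)
    (o : Draw d) :
    lossEstimate W lam u ell o =
      invSqrtFactor lam u * coreEstimate ell o * (invSqrtFactor lam u)ᵀ := by
  rcases o with i | s
  · simp only [lossEstimate, coreEstimate, Matrix.mul_smul, Matrix.smul_mul]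
    congr 1
    rw [outer_eq_vecMulVec, action_inl, vecMulVec_mulVec_mulVec, invSqrt, sum_smul_outer,
      invSqrtFactor, Matrix.transpose_mul, Matrix.diagonal_transpose]
    set O := basisMatrix u
    set E := vecMulVec (Pi.single i (1 : ℝ)) (Pi.single i (1 : ℝ))
    set D := diagonal fun i => (√(lam i))⁻¹
    calc O * D * Oᵀ * (O * E * Oᵀ) * (O * D * Oᵀ)
        = O * D * (Oᵀ * O) * E * (Oᵀ * O) * D * Oᵀ := by simp only [Matrix.mul_assoc]
      _ = O * D * E * (D * Oᵀ) := by
        rw [basisMatrix_transpose_mul]; simp only [Matrix.mul_assoc, Matrix.mul_one]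
  · simp only [lossEstimate, coreEstimate, Matrix.mul_smul, Matrix.smul_mul]
    congr 1
    rw [outer_eq_vecMulVec, action_inr, vecMulVec_mulVec_mulVec, h.inv_eq hlam, Matrix.mul_sub,
      Matrix.sub_mul, Matrix.mul_one]
    congr 1
    set G := invSqrtFactor lam u
    set H := sqrtFactor lam u
    set E := vecMulVec (signVec s) (signVec s)
    calc G * Gᵀ * (H * E * Hᵀ) * (G * Gᵀ)
        = G * (Gᵀ * H) * E * (Hᵀ * G) * Gᵀ := by simp only [Matrix.mul_assoc]
      _ = _ := by
        rw [invSqrtFactor_transpose_mul_sqrtFactor hlam,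
          sqrtFactor_transpose_mul_invSqrtFactor hlam]
        simp only [Matrix.mul_one]

lemma abs_coreEstimate_le {ell : ℝ} (h0 : 0 ≤ ell) (h1 : ell ≤ 1) (o : Draw d) (i j : Fin d) :
    |coreEstimate ell o i j| ≤ 2 := by
  rcases o with k | s
  · simp only [coreEstimate, Matrix.smul_apply, vecMulVec_apply, smul_eq_mul, Pi.single_apply]
    split_ifs <;> simp [abs_of_nonneg, h0, h1]
  · simp only [coreEstimate, Matrix.smul_apply, vecMulVec_apply, smul_eq_mul, Matrix.sub_apply,
      signVec, Matrix.one_apply]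
    rw [abs_mul, abs_of_nonneg h0]
    have : |((s i : ℤ) : ℝ) * ((s j : ℤ) : ℝ) - if i = j then 1 else 0| ≤ 2 := by
      rcases Int.units_eq_one_or (s i) with h | h <;> rcases Int.units_eq_one_or (s j) with h' | h' <;>
        rw [h, h'] <;> split_ifs <;> norm_num
    calc ell * _ ≤ 1 * 2 := mul_le_mul h1 this (abs_nonneg _) zero_le_one
      _ = 2 := by norm_num

lemma signVec_dotProduct_self (s : Fin d → ℤˣ) : signVec s ⬝ᵥ signVec s = d := by
  simp [dotProduct, signVec_mul_self]

end Factors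

/-! ### The second-order estimate for `log det` in one round. -/

section LogDetCore

variable {d : ℕ}

lemma det_one_add_smul_vecMulVec (c : ℝ) (v : Fin d → ℝ) :
    (1 + c • vecMulVec v v).det = 1 + c * (v ⬝ᵥ v) := by
  have := Matrix.det_one_add_replicateCol_mul_replicateRow (ι := Unit) (c • v) v
  rw [← Matrix.vecMulVec_eq, Matrix.smul_vecMulVec] at this
  rw [this, dotProduct_smul, smul_eq_mul]

lemma posDef_one_add_smul_vecMulVec {c : ℝ} (hc : 0 ≤ c) (v : Fin d → ℝ) :
    (1 + c • vecMulVec v v).PosDef := by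
  refine Matrix.PosDef.one.add_posSemidef (Matrix.PosSemidef.smul ?_ hc)
  simpa using Matrix.posSemidef_vecMulVec_self_star v

/-- The whitened update is positive definite and its `log det` exceeds its linearization up to a
second order term. -/
lemma coreEstimate_log_det {η ell : ℝ} (hη : 0 ≤ η) (hη1 : η ≤ 1 / 2) (h0 : 0 ≤ ell)
    (h1 : ell ≤ 1) (hd : 1 ≤ d) (o : Draw d) :
    (1 + η • coreEstimate ell o).PosDef ∧
      η * (coreEstimate ell o).trace - 2 * η ^ 2 * (d : ℝ) ^ 2 * ell ≤
        Real.log (1 + η • coreEstimate ell o).det := by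
  have hd1 : (1 : ℝ) ≤ d := by exact_mod_cast hd
  -- The source of the first-order bound: the quadratic error is charged to the loss itself.
  have hell : ell ^ 2 ≤ ell := by nlinarith
  have hx0 : 0 ≤ η * ell := mul_nonneg hη h0
  have hx1 : η * ell ≤ 1 / 2 := by nlinarith
  have hx2 : (η * ell) ^ 2 * (d : ℝ) ^ 2 ≤ η ^ 2 * (d : ℝ) ^ 2 * ell := by
    have := mul_le_mul_of_nonneg_left hell (mul_nonneg (sq_nonneg η) (sq_nonneg (d : ℝ)))
    nlinarith
  set x := η * ell with hx
  rcases o with i | s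
  · have heq : η • coreEstimate ell (Sum.inl i : Draw d) =
        (2 * x) • vecMulVec (Pi.single i 1) (Pi.single i 1) := by
      rw [coreEstimate, smul_smul]; congr 1; ring
    rw [heq, det_one_add_smul_vecMulVec]
    refine ⟨posDef_one_add_smul_vecMulVec (by positivity) _, ?_⟩
    have htr : (coreEstimate ell (Sum.inl i : Draw d)).trace = 2 * ell := by
      simp [coreEstimate, Matrix.trace_vecMulVec]
    rw [htr]
    have hlog := Real.le_log_one_add_of_nonneg (x := 2 * x) (by positivity)
    -- This is `z - z²/2 ≤ 2z/(z+2)` at `z = 2x`; the right side bounds `log (1 + z)` from below.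
    have h2 : 2 * x - 2 * x ^ 2 ≤ 2 * (2 * x) / (2 * x + 2) := by
      rw [le_div_iff₀ (by positivity)]
      nlinarith [mul_nonneg hx0 (sq_nonneg x)]
    have h3 : x ^ 2 ≤ x ^ 2 * (d : ℝ) ^ 2 := by
      have : (1 : ℝ) ≤ (d : ℝ) ^ 2 := by nlinarith
      nlinarith [sq_nonneg x]
    simp only [dotProduct_single, Pi.single_eq_same, mul_one]
    have h4 : η * (2 * ell) = 2 * x := by rw [hx]; ring
    linarith
  · have hpos : 0 < 1 - x := by linarith
    set y := x / (1 - x) with hy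
    have hy0 : 0 ≤ y := div_nonneg hx0 hpos.le
    -- Writing `(1-x)I + x s sᵀ` as a multiple of a rank-one perturbation gives the determinant
    -- `(1-x)^d (1 + yd)`.
    have heq : 1 + η • coreEstimate ell (Sum.inr s : Draw d) =
        (1 - x) • (1 + y • vecMulVec (signVec s) (signVec s)) := by
      rw [coreEstimate, smul_smul, ← hx, smul_add, smul_smul, hy, mul_div_cancel₀ _ hpos.ne',
        smul_sub, sub_smul, one_smul]
      abel
    have htr : (coreEstimate ell (Sum.inr s : Draw d)).trace = 0 := by
      simp [coreEstimate, Matrix.trace_vecMulVec, signVec_dotProduct_self]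
    rw [heq, htr, Matrix.det_smul, det_one_add_smul_vecMulVec, signVec_dotProduct_self,
      Fintype.card_fin]
    refine ⟨Matrix.PosDef.smul (posDef_one_add_smul_vecMulVec hy0 _) hpos, ?_⟩
    have hyd : 0 ≤ y * d := by positivity
    rw [Real.log_mul (by positivity) (by positivity), Real.log_pow]
    have hlog1 := Real.one_sub_inv_le_log_of_pos hpos
    have hlog2 := Real.le_log_one_add_of_nonneg hyd
    -- Hence `d log(1-x) ≥ -dy`, which cancels the linear part of `log(1 + yd)`; only `(yd)²/2`
    -- remains.
    have hy1 : 1 - (1 - x)⁻¹ = - y := by rw [hy]; field_simp; ring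
    have h2 : y * d - (y * d) ^ 2 / 2 ≤ 2 * (y * d) / (y * d + 2) := by
      rw [le_div_iff₀ (by positivity)]
      nlinarith [mul_nonneg hyd (sq_nonneg (y * d))]
    -- Uses `x ≤ 1/2`. It turns `(yd)²/2` into `2x²d²`, which fixes the constant 2 in the error
    -- term.
    have hy2 : y ≤ 2 * x := by
      rw [hy, div_le_iff₀ hpos]; nlinarith
    have h3 : (y * d) ^ 2 ≤ 4 * (x ^ 2 * (d : ℝ) ^ 2) := by
      have : (y * d) ^ 2 ≤ (2 * x * d) ^ 2 := by gcongr
      linarith [this, show (2 * x * d) ^ 2 = 4 * (x ^ 2 * (d : ℝ) ^ 2) by ring]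
    have h4 : (d : ℝ) * (-y) ≤ d * Real.log (1 - x) := by
      rw [← hy1]; gcongr
    nlinarith

end LogDetCore

/-! ### One round: size, `log det` and conditional mean of the loss estimate. -/

section Round

variable {d : ℕ} {W : Matrix (Fin d) (Fin d) ℝ} {lam : Fin d → ℝ}
  {u : OrthonormalBasis (Fin d) ℝ (EuclideanSpace ℝ (Fin d))}

lemma trace_mul_lossEstimate (h : IsEigendecomposition W lam u) (hlam : ∀ i, 0 < lam i)
    (ell : ℝ) (o : Draw d) :
    (W * lossEstimate W lam u ell o).trace = (coreEstimate ell o).trace := by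
  rw [lossEstimate_eq h hlam, h.eq_sqrtFactor hlam]
  set G := invSqrtFactor lam u
  set H := sqrtFactor lam u
  set M := coreEstimate ell o
  calc (H * Hᵀ * (G * M * Gᵀ)).trace = ((H * (Hᵀ * G) * M) * Gᵀ).trace := by
        simp only [Matrix.mul_assoc]
    _ = (Gᵀ * (H * (Hᵀ * G) * M)).trace := Matrix.trace_mul_comm _ _
    _ = ((Gᵀ * H) * (Hᵀ * G) * M).trace := by simp only [Matrix.mul_assoc]
    _ = M.trace := by
      rw [sqrtFactor_transpose_mul_invSqrtFactor hlam, invSqrtFactor_transpose_mul_sqrtFactor hlam]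
      simp

lemma inv_diag_eq_sum (h : IsEigendecomposition W lam u) (hlam : ∀ i, 0 < lam i) (a : Fin d) :
    W⁻¹ a a = ∑ i, invSqrtFactor lam u a i ^ 2 := by
  rw [h.inv_eq hlam, Matrix.mul_apply]
  exact Finset.sum_congr rfl fun i _ => by rw [Matrix.transpose_apply, sq]

/-- Needed only for integrability. The squared rows of `G` sum to the diagonal of `W⁻¹`, so a crude
entrywise bound follows from `2|xy| ≤ x² + y²`. -/
lemma abs_lossEstimate_le (h : IsEigendecomposition W lam u) (hW : W.PosDef) {ell : ℝ}
    (h0 : 0 ≤ ell) (h1 : ell ≤ 1) (o : Draw d) (a b : Fin d) :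
    |lossEstimate W lam u ell o a b| ≤ 2 * d * W⁻¹.trace := by
  have hlam := h.eigenvalue_pos hW
  rw [lossEstimate_eq h hlam, Matrix.mul_apply]
  set G := invSqrtFactor lam u with hG
  set M := coreEstimate ell o
  have hterm : ∀ j i : Fin d, |G a i * M i j * Gᵀ j b| ≤ G a i ^ 2 + G b j ^ 2 := by
    intro j i
    rw [abs_mul, abs_mul, Matrix.transpose_apply]
    have hM : |M i j| ≤ 2 := abs_coreEstimate_le h0 h1 o i j
    calc |G a i| * |M i j| * |G b j| ≤ |G a i| * 2 * |G b j| := by gcongr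
      _ ≤ |G a i| ^ 2 + |G b j| ^ 2 := by nlinarith [sq_nonneg (|G a i| - |G b j|)]
      _ = _ := by rw [sq_abs, sq_abs]
  have hdiag : ∀ c, W⁻¹ c c ≤ W⁻¹.trace := fun c =>
    Finset.single_le_sum (f := fun c => W⁻¹ c c) (fun c _ => hW.inv.diag_pos.le)
      (Finset.mem_univ c)
  calc |∑ j, (G * M) a j * Gᵀ j b|
      ≤ ∑ j, ∑ i, (G a i ^ 2 + G b j ^ 2) := by
        refine (Finset.abs_sum_le_sum_abs _ _).trans (Finset.sum_le_sum fun j _ => ?_)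
        rw [Matrix.mul_apply, Finset.sum_mul]
        exact (Finset.abs_sum_le_sum_abs _ _).trans (Finset.sum_le_sum fun i _ => hterm j i)
    _ = d * W⁻¹ a a + d * W⁻¹ b b := by
        rw [inv_diag_eq_sum h hlam, inv_diag_eq_sum h hlam, ← hG]
        simp [Finset.sum_add_distrib, Finset.mul_sum]
    _ ≤ d * W⁻¹.trace + d * W⁻¹.trace := by gcongr <;> exact hdiag _
    _ = _ := by ring

lemma trace_lossEstimate_le (h : IsEigendecomposition W lam u) (hW : W.PosDef) {ell : ℝ}
    (h0 : 0 ≤ ell) (h1 : ell ≤ 1) (o : Draw d) :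
    (lossEstimate W lam u ell o).trace ≤ 2 * d ^ 2 * W⁻¹.trace := by
  calc (lossEstimate W lam u ell o).trace
      ≤ ∑ _ : Fin d, 2 * d * W⁻¹.trace :=
        Finset.sum_le_sum fun a _ =>
          (le_abs_self _).trans (abs_lossEstimate_le h hW h0 h1 o a a)
    _ = _ := by simp; ring

/-- Pulling the estimate back to the whitened coordinates of the update. -/
lemma log_det_inv_add_lossEstimate (h : IsEigendecomposition W lam u) (hW : W.PosDef)
    {η ell : ℝ} (hη : 0 ≤ η) (hη1 : η ≤ 1 / 2) (h0 : 0 ≤ ell) (h1 : ell ≤ 1) (hd : 1 ≤ d)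
    (o : Draw d) :
    (W⁻¹ + η • lossEstimate W lam u ell o).PosDef ∧
      Real.log W⁻¹.det + η * (W * lossEstimate W lam u ell o).trace -
          2 * η ^ 2 * (d : ℝ) ^ 2 * ell ≤
        Real.log (W⁻¹ + η • lossEstimate W lam u ell o).det := by
  have hlam := h.eigenvalue_pos hW
  obtain ⟨hpd, hlog⟩ := coreEstimate_log_det hη hη1 h0 h1 hd o
  rw [trace_mul_lossEstimate h hlam]
  have heq : W⁻¹ + η • lossEstimate W lam u ell o =
      invSqrtFactor lam u * (1 + η • coreEstimate ell o) * (invSqrtFactor lam u)ᵀ := by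
    rw [lossEstimate_eq h hlam, h.inv_eq hlam, Matrix.mul_add, Matrix.add_mul, Matrix.mul_one,
      Matrix.mul_smul, Matrix.smul_mul]
  have hdet : (W⁻¹ + η • lossEstimate W lam u ell o).det =
      W⁻¹.det * (1 + η • coreEstimate ell o).det := by
    rw [heq, h.inv_eq hlam]
    simp only [Matrix.det_mul]
    ring
  have hu : IsUnit (invSqrtFactor lam u) :=
    IsUnit.of_mul_eq_one _ (invSqrtFactor_mul_sqrtFactor_transpose hlam)
  refine ⟨?_, ?_⟩
  · have := (Matrix.IsUnit.posDef_star_right_conjugate_iff hu).2 hpd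
    rw [heq]
    rwa [Matrix.star_eq_conjTranspose, Matrix.conjTranspose_eq_transpose_of_trivial] at this
  · rw [hdet, Real.log_mul hW.inv.det_pos.ne' hpd.det_pos.ne']
    linarith

/-- The loss of a draw, as seen by the learner. -/
lemma frob_outer (w : EuclideanSpace ℝ (Fin d)) (L : Matrix (Fin d) (Fin d) ℝ) :
    frob (outer w) L = w.ofLp ⬝ᵥ L *ᵥ w.ofLp := by
  rw [dotProduct_mulVec_eq_sum, frob, Matrix.trace, Finset.sum_comm]
  simp [Matrix.mul_apply, outer, mul_comm]

lemma frob_outer_nonneg {L : Matrix (Fin d) (Fin d) ℝ} (hL : L.PosSemidef)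
    (w : EuclideanSpace ℝ (Fin d)) : 0 ≤ frob (outer w) L := by
  rw [frob_outer]
  simpa using hL.dotProduct_mulVec_nonneg w.ofLp

lemma frob_outer_le {L : Matrix (Fin d) (Fin d) ℝ} (hL : IsLossMatrix L)
    {w : EuclideanSpace ℝ (Fin d)} (hw : ‖w‖ = 1) : frob (outer w) L ≤ 1 := by
  rw [frob_outer]
  have h1 : w.ofLp ⬝ᵥ L *ᵥ w.ofLp =
      inner ℝ w (Matrix.toEuclideanCLM (n := Fin d) (𝕜 := ℝ) L w) := by
    rw [PiLp.inner_apply]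
    simp [dotProduct, mul_comm, Matrix.ofLp_toEuclideanCLM]
  rw [h1]
  calc _ ≤ ‖w‖ * ‖Matrix.toEuclideanCLM (n := Fin d) (𝕜 := ℝ) L w‖ := real_inner_le_norm _ _
    _ ≤ ‖w‖ * (‖Matrix.toEuclideanCLM (n := Fin d) (𝕜 := ℝ) L‖ * ‖w‖) := by
      gcongr; exact ContinuousLinearMap.le_opNorm _ _
    _ ≤ 1 := by rw [hw]; simpa using hL.2

lemma norm_action (hlam : ∀ i, 0 < lam i) (hsum : ∑ i, lam i = 1) (o : Draw d) :
    ‖action lam u o‖ = 1 := by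
  rcases o with i | s
  · exact u.orthonormal.1 i
  · have h : ‖action lam u (Sum.inr s)‖ ^ 2 = 1 := by
      rw [← real_inner_self_eq_norm_sq, action, u.orthonormal.inner_sum, ← hsum]
      refine Finset.sum_congr rfl fun i _ => ?_
      simp only [conj_trivial]
      have h1 := intUnit_cast_sq (s i)
      have h2 := Real.mul_self_sqrt (hlam i).le
      linear_combination (√(lam i) * √(lam i)) * h1 + h2
    have := norm_nonneg (action lam u (Sum.inr s))
    nlinarith

lemma mulVec_dotProduct_mulVec_mulVec (A L : Matrix (Fin d) (Fin d) ℝ) (x : Fin d → ℝ) :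
    (A *ᵥ x) ⬝ᵥ L *ᵥ (A *ᵥ x) = x ⬝ᵥ (Aᵀ * L * A) *ᵥ x := by
  rw [← Matrix.mulVec_mulVec, ← Matrix.mulVec_mulVec, Matrix.dotProduct_mulVec x Aᵀ,
    Matrix.vecMul_transpose]

/-- The probability of the draw supplies the two factors `√λ_i` that turn the eigenvector loss into
a diagonal entry of `Hᵀ L H`. -/
lemma frob_action_inl (hlam : ∀ i, 0 < lam i) (L : Matrix (Fin d) (Fin d) ℝ) (i : Fin d) :
    lam i * frob (outer (action lam u (Sum.inl i))) L =
      ((sqrtFactor lam u)ᵀ * L * sqrtFactor lam u) i i := by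
  rw [frob_outer, action_inl, sqrtFactor, Matrix.transpose_mul, Matrix.diagonal_transpose]
  have h1 : (basisMatrix u *ᵥ Pi.single i 1) ⬝ᵥ L *ᵥ (basisMatrix u *ᵥ Pi.single i 1) =
      ((basisMatrix u)ᵀ * L * basisMatrix u) i i := by
    rw [mulVec_dotProduct_mulVec_mulVec]; simp
  rw [h1]
  have h2 : diagonal (fun i => √(lam i)) * (basisMatrix u)ᵀ * L *
      (basisMatrix u * diagonal fun i => √(lam i)) =
      diagonal (fun i => √(lam i)) * ((basisMatrix u)ᵀ * L * basisMatrix u) *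
        diagonal fun i => √(lam i) := by simp only [Matrix.mul_assoc]
  rw [h2, Matrix.mul_diagonal, Matrix.diagonal_mul]
  have h3 := Real.mul_self_sqrt (hlam i).le
  linear_combination -((basisMatrix u)ᵀ * L * basisMatrix u) i i * h3

lemma frob_action_inr (L : Matrix (Fin d) (Fin d) ℝ) (s : Fin d → ℤˣ) :
    frob (outer (action lam u (Sum.inr s))) L =
      signVec s ⬝ᵥ ((sqrtFactor lam u)ᵀ * L * sqrtFactor lam u) *ᵥ signVec s := by
  rw [frob_outer, action_inr, mulVec_dotProduct_mulVec_mulVec]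

/-- The mean of the observed loss. -/
lemma sum_drawProb_frob (h : IsEigendecomposition W lam u) (hlam : ∀ i, 0 < lam i)
    (L : Matrix (Fin d) (Fin d) ℝ) :
    ∑ o, drawProb lam o * frob (outer (action lam u o)) L = (W * L).trace := by
  set N := (sqrtFactor lam u)ᵀ * L * sqrtFactor lam u with hN
  have htr : N.trace = (W * L).trace := by
    rw [hN, Matrix.trace_mul_comm, ← Matrix.mul_assoc, ← h.eq_sqrtFactor hlam]
  have h2 : (1 / 2 : ℝ) ^ d * 2 ^ d = 1 := by rw [← mul_pow]; norm_num
  rw [Fintype.sum_sum_type]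
  have hl : ∀ i, drawProb lam (Sum.inl i) * frob (outer (action lam u (Sum.inl i))) L =
      1 / 2 * N i i := by
    intro i
    rw [drawProb, mul_assoc, frob_action_inl hlam]
  rw [Finset.sum_congr rfl fun i _ => hl i]
  simp only [drawProb, frob_action_inr, ← hN, ← Finset.mul_sum, sum_signVec_quadratic]
  rw [← htr, show ∑ i, N i i = N.trace from rfl]
  linear_combination (1 / 2 * N.trace) * h2

/-- The two kinds of draws divide the work. Eigenvector draws recover the diagonal of `N = Hᵀ L H`,
their factor 2 undoing the coin. Dense draws recover the rest: `s sᵀ - I` has zero diagonal, and off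
the diagonal the mean is `(N_ab + N_ba)/2`, where symmetry of `L` plays the role of the factor 2. -/
lemma sum_drawProb_coreEstimate (hlam : ∀ i, 0 < lam i) {L : Matrix (Fin d) (Fin d) ℝ}
    (hL : L.IsSymm) :
    ∑ o, drawProb lam o • coreEstimate (frob (outer (action lam u o)) L) o =
      (sqrtFactor lam u)ᵀ * L * sqrtFactor lam u := by
  set N := (sqrtFactor lam u)ᵀ * L * sqrtFactor lam u with hN
  have hNsymm : ∀ a b, N a b = N b a := by
    have : Nᵀ = N := by
      rw [hN, Matrix.transpose_mul, Matrix.transpose_mul, Matrix.transpose_transpose, hL.eq,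
        Matrix.mul_assoc]
    intro a b
    exact congrFun (congrFun this b) a
  have h2 : (1 / 2 : ℝ) ^ d * 2 ^ d = 1 := by rw [← mul_pow]; norm_num
  have hl : ∀ i, drawProb lam (Sum.inl i) •
      coreEstimate (frob (outer (action lam u (Sum.inl i))) L) (Sum.inl i) =
      diagonal (Pi.single i (N i i)) := by
    intro i
    rw [drawProb, coreEstimate, smul_smul]
    have : 1 / 2 * lam i * (2 * frob (outer (action lam u (Sum.inl i))) L) = N i i := by
      rw [hN, ← frob_action_inl hlam]; ring
    rw [this]
    ext a b
    simp only [Matrix.smul_apply, vecMulVec_apply, Pi.single_apply, diagonal_apply, smul_eq_mul]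
    split_ifs <;> simp_all
  ext a b
  rw [Fintype.sum_sum_type, Finset.sum_congr rfl fun i _ => hl i, Matrix.add_apply,
    Matrix.sum_apply, Matrix.sum_apply]
  simp only [drawProb, coreEstimate, Matrix.smul_apply, Matrix.sub_apply, frob_action_inr, ← hN,
    smul_eq_mul, vecMulVec_apply, ← Finset.mul_sum]
  by_cases hab : a = b
  · subst hab
    simp [signVec_mul_self, Pi.single_apply]
  · simp only [Matrix.one_apply_ne hab, sub_zero, sum_signVec_quadratic_mul N hab,
      diagonal_apply_ne _ hab, Finset.sum_const_zero, zero_add]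
    rw [hNsymm b a]
    linear_combination (N a b) * h2

/-- The loss estimate is unbiased. -/
lemma sum_drawProb_lossEstimate (h : IsEigendecomposition W lam u) (hlam : ∀ i, 0 < lam i)
    {L : Matrix (Fin d) (Fin d) ℝ} (hL : L.IsSymm) :
    ∑ o, drawProb lam o • lossEstimate W lam u (frob (outer (action lam u o)) L) o = L := by
  have h1 : ∑ o, drawProb lam o • lossEstimate W lam u (frob (outer (action lam u o)) L) o =
      invSqrtFactor lam u * (∑ o, drawProb lam o •
        coreEstimate (frob (outer (action lam u o)) L) o) * (invSqrtFactor lam u)ᵀ := by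
    rw [Matrix.mul_sum, Matrix.sum_mul]
    refine Finset.sum_congr rfl fun o _ => ?_
    rw [lossEstimate_eq h hlam, Matrix.mul_smul, Matrix.smul_mul]
  rw [h1, sum_drawProb_coreEstimate hlam hL]
  set G := invSqrtFactor lam u
  set H := sqrtFactor lam u
  calc G * (Hᵀ * L * H) * Gᵀ = (G * Hᵀ) * L * (H * Gᵀ) := by simp only [Matrix.mul_assoc]
    _ = L := by
      rw [invSqrtFactor_mul_sqrtFactor_transpose hlam, sqrtFactor_mul_invSqrtFactor_transpose hlam]
      simp

end Round

/-! ### Potential decrease in one update, and the comparator. -/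

section MirrorDescent

variable {d : ℕ} {W W' : Matrix (Fin d) (Fin d) ℝ} {lam : Fin d → ℝ}
  {u : OrthonormalBasis (Fin d) ℝ (EuclideanSpace ℝ (Fin d))}

lemma IsUpdate.posDef {η : ℝ} {Lest : Matrix (Fin d) (Fin d) ℝ} (h : IsUpdate η W Lest W') :
    W'.PosDef ∧ W'.trace = 1 := by
  obtain ⟨β, hpd, rfl, htr⟩ := h
  exact ⟨hpd.inv, htr⟩

/-- The part of the Bregman divergence from `U` to `W` that depends on `W`. -/
def potential (U W : Matrix (Fin d) (Fin d) ℝ) : ℝ := (W⁻¹ * U).trace - Real.log W⁻¹.det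

/-- The shift by `β` adds `β tr U = β` to the linear part of the potential and raises `log det W⁻¹`
by at least `β`, so it can only help. The remainder is the `log det` estimate of the round, with
`(coreEstimate ell o).trace` standing for `tr(W L̃)`. -/
lemma update_potential_le (h : IsEigendecomposition W lam u) (hW : W.PosDef)
    {η ell : ℝ} (hη : 0 ≤ η) (hη1 : η ≤ 1 / 2) (h0 : 0 ≤ ell) (h1 : ell ≤ 1) (hd : 1 ≤ d)
    (o : Draw d) (hup : IsUpdate η W (lossEstimate W lam u ell o) W')
    {U : Matrix (Fin d) (Fin d) ℝ} (hU : U.trace = 1) :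
    η * ((coreEstimate ell o).trace - (U * lossEstimate W lam u ell o).trace) -
        2 * η ^ 2 * (d : ℝ) ^ 2 * ell ≤ potential U W - potential U W' := by
  obtain ⟨hQ, hlog⟩ := log_det_inv_add_lossEstimate h hW hη hη1 h0 h1 hd o
  rw [trace_mul_lossEstimate h (h.eigenvalue_pos hW)] at hlog
  obtain ⟨β, hpd, rfl, htr⟩ := hup
  obtain ⟨hβ, -⟩ := log_det_le_of_trace_inv_eq_one hQ hpd htr
  rw [potential, potential, Matrix.nonsing_inv_nonsing_inv _
    (isUnit_iff_ne_zero.2 hpd.det_pos.ne')]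
  simp only [Matrix.add_mul, Matrix.smul_mul, Matrix.trace_add, Matrix.trace_smul, Matrix.one_mul,
    hU, smul_eq_mul, mul_one]
  rw [Matrix.trace_mul_comm (lossEstimate W lam u ell o) U]
  linarith

/-- A deterministic recursion that keeps `W⁻¹`, and with it the loss estimates, bounded over the
probability space. The term `d * d` is `β tr I` with `β ≤ d`. -/
lemma update_trace_inv_le (h : IsEigendecomposition W lam u) (hW : W.PosDef)
    {η ell : ℝ} (hη : 0 ≤ η) (hη1 : η ≤ 1 / 2) (h0 : 0 ≤ ell) (h1 : ell ≤ 1) (hd : 1 ≤ d)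
    (o : Draw d) (hup : IsUpdate η W (lossEstimate W lam u ell o) W') :
    W'⁻¹.trace ≤ W⁻¹.trace + η * (2 * d ^ 2 * W⁻¹.trace) + d * d := by
  obtain ⟨hQ, -⟩ := log_det_inv_add_lossEstimate h hW hη hη1 h0 h1 hd o
  obtain ⟨β, hpd, rfl, htr⟩ := hup
  obtain ⟨-, hβ⟩ := log_det_le_of_trace_inv_eq_one hQ hpd htr
  rw [Matrix.nonsing_inv_nonsing_inv _ (isUnit_iff_ne_zero.2 hpd.det_pos.ne')]
  simp only [Matrix.trace_add, Matrix.trace_smul, smul_eq_mul, Matrix.trace_one, Fintype.card_fin]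
    at hβ ⊢
  gcongr
  exact trace_lossEstimate_le h hW h0 h1 o

lemma le_potential {U : Matrix (Fin d) (Fin d) ℝ} (hW : W.PosDef) (hU : U.PosDef) :
    d + Real.log U.det ≤ potential U W := by
  have := log_det_le_log_det_add hW hU
  rw [potential, Matrix.det_nonsing_inv, Ring.inverse_eq_inv', Real.log_inv]
  rw [Fintype.card_fin] at this
  linarith

lemma potential_uniform (hd : 1 ≤ d) {U : Matrix (Fin d) (Fin d) ℝ} (hU : U.trace = 1) :
    potential U ((1 / (d : ℝ)) • (1 : Matrix (Fin d) (Fin d) ℝ)) = d - d * Real.log d := by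
  have hd0 : (d : ℝ) ≠ 0 := by positivity
  have hinv : ((1 / (d : ℝ)) • (1 : Matrix (Fin d) (Fin d) ℝ))⁻¹ = (d : ℝ) • 1 := by
    refine Matrix.inv_eq_right_inv ?_
    rw [Matrix.smul_mul, Matrix.one_mul, smul_smul, one_div_mul_cancel hd0, one_smul]
  rw [potential, hinv, Matrix.smul_mul, Matrix.one_mul, Matrix.trace_smul, hU, Matrix.det_smul,
    Matrix.det_one, Fintype.card_fin, mul_one, Real.log_pow]
  simp

/-- The comparator: the projection on `v`, mixed with the uniform density matrix. -/
def comparator (T : ℕ) (v : EuclideanSpace ℝ (Fin d)) : Matrix (Fin d) (Fin d) ℝ :=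
  (1 / (d * T : ℝ)) • 1 + (1 - 1 / (T : ℝ)) • outer v

lemma dotProduct_self_of_norm_eq_one {v : EuclideanSpace ℝ (Fin d)} (hv : ‖v‖ = 1) :
    v.ofLp ⬝ᵥ v.ofLp = 1 := by
  have : inner ℝ v v = (1 : ℝ) := by rw [real_inner_self_eq_norm_sq, hv]; norm_num
  rw [PiLp.inner_apply] at this
  rw [← this]
  exact Finset.sum_congr rfl fun i _ => by simp [sq]

lemma trace_comparator (hd : 1 ≤ d) {T : ℕ} (hT : 1 ≤ T) {v : EuclideanSpace ℝ (Fin d)}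
    (hv : ‖v‖ = 1) : (comparator T v).trace = 1 := by
  have hd0 : (d : ℝ) ≠ 0 := by positivity
  have hT0 : (T : ℝ) ≠ 0 := by positivity
  rw [comparator, Matrix.trace_add, Matrix.trace_smul, Matrix.trace_smul, outer_eq_vecMulVec,
    Matrix.trace_vecMulVec, dotProduct_self_of_norm_eq_one hv, Matrix.trace_one, Fintype.card_fin]
  simp only [smul_eq_mul]
  field_simp
  ring

lemma one_sub_one_div_nonneg {T : ℕ} (hT : 1 ≤ T) : 0 ≤ 1 - 1 / (T : ℝ) := by
  have hT1 : (1 : ℝ) ≤ T := by exact_mod_cast hT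
  rw [sub_nonneg, div_le_one (by positivity)]
  exact hT1

lemma comparator_posDef (hd : 1 ≤ d) {T : ℕ} (hT : 1 ≤ T) {v : EuclideanSpace ℝ (Fin d)}
    (hv : ‖v‖ = 1) :
    (comparator T v).PosDef ∧ -(d * Real.log (d * T)) ≤ Real.log (comparator T v).det := by
  have hd0 : (0 : ℝ) < d := by positivity
  have hT0 : (0 : ℝ) < T := by positivity
  have hT1 := one_sub_one_div_nonneg hT
  -- The rank-one perturbation contributes a factor at least 1, so the determinant is at least
  -- `(dT)^{-d}`.
  have heq : comparator T v =
      (1 / (d * T : ℝ)) • (1 + (d * T * (1 - 1 / (T : ℝ))) • vecMulVec v.ofLp v.ofLp) := by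
    rw [comparator, outer_eq_vecMulVec, smul_add, smul_smul]
    congr 2
    field_simp
  have hc : 0 ≤ d * T * (1 - 1 / (T : ℝ)) := by positivity
  rw [heq]
  refine ⟨(posDef_one_add_smul_vecMulVec hc _).smul (by positivity), ?_⟩
  rw [Matrix.det_smul, det_one_add_smul_vecMulVec, dotProduct_self_of_norm_eq_one hv, Fintype.card_fin,
    Real.log_mul (x := (1 / (d * T : ℝ)) ^ d) (by positivity) (by positivity), Real.log_pow,
    one_div (d * T : ℝ), Real.log_inv]
  have := Real.log_nonneg (x := 1 + d * T * (1 - 1 / (T : ℝ)) * 1) (by linarith)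
  linarith

end MirrorDescent

/-! ### Pathwise regret bound and uniform boundedness along a run. -/

section Run

variable {Ω : Type*} {mΩ : MeasurableSpace Ω} {d : ℕ} {η : ℝ} {T : ℕ} {μ : Measure Ω}
  {ℱ : Filtration ℕ mΩ} {L W : ℕ → Ω → Matrix (Fin d) (Fin d) ℝ} {lam : ℕ → Ω → Fin d → ℝ}
  {u : ℕ → Ω → OrthonormalBasis (Fin d) ℝ (EuclideanSpace ℝ (Fin d))} {D : ℕ → Ω → Draw d}

lemma IsDenseRun.posDef (h : IsDenseRun η T μ ℱ L W lam u D) (hd : 1 ≤ d) {t : ℕ} (ht : t ≤ T)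
    (ω : Ω) : (W t ω).PosDef ∧ (W t ω).trace = 1 := by
  have hd0 : (0 : ℝ) < d := by positivity
  cases t with
  | zero =>
    rw [h.init]
    refine ⟨Matrix.PosDef.one.smul (by positivity), ?_⟩
    rw [Matrix.trace_smul, Matrix.trace_one, Fintype.card_fin, smul_eq_mul,
      one_div_mul_cancel hd0.ne']
  | succ t => exact (h.update t ht ω).posDef

/-- The loss that the draw `o` would incur in round `t`. -/
def lossOf (L : ℕ → Ω → Matrix (Fin d) (Fin d) ℝ) (lam : ℕ → Ω → Fin d → ℝ)
    (u : ℕ → Ω → OrthonormalBasis (Fin d) ℝ (EuclideanSpace ℝ (Fin d))) (t : ℕ) (ω : Ω)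
    (o : Draw d) : ℝ :=
  frob (outer (action (lam t ω) (u t ω) o)) (L t ω)

lemma IsDenseRun.eigenvalue_pos (h : IsDenseRun η T μ ℱ L W lam u D) (hd : 1 ≤ d) {t : ℕ}
    (ht : t < T) (ω : Ω) (i : Fin d) : 0 < lam t ω i :=
  (h.eigendecomposition t ht ω).eigenvalue_pos (h.posDef hd ht.le ω).1 i

lemma IsDenseRun.lossOf_le_one (h : IsDenseRun η T μ ℱ L W lam u D) (hd : 1 ≤ d)
    (hL : ∀ t < T, ∀ ω, IsLossMatrix (L t ω)) {t : ℕ} (ht : t < T) (ω : Ω) (o : Draw d) :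
    lossOf L lam u t ω o ≤ 1 := by
  refine frob_outer_le (hL t ht ω) (norm_action (h.eigenvalue_pos hd ht ω) ?_ o)
  rw [(h.eigendecomposition t ht ω).sum_eigenvalues, (h.posDef hd ht.le ω).2]

lemma lossOf_nonneg (hpsd : ∀ t < T, ∀ ω, (L t ω).PosSemidef) {t : ℕ} (ht : t < T) (ω : Ω)
    (o : Draw d) : 0 ≤ lossOf L lam u t ω o :=
  frob_outer_nonneg (hpsd t ht ω) _

/-- The estimated gap between the losses of the learner and of `U`. -/
def estimatedGap (L W : ℕ → Ω → Matrix (Fin d) (Fin d) ℝ) (lam : ℕ → Ω → Fin d → ℝ)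
    (u : ℕ → Ω → OrthonormalBasis (Fin d) ℝ (EuclideanSpace ℝ (Fin d)))
    (U : Matrix (Fin d) (Fin d) ℝ) (t : ℕ) (ω : Ω) (o : Draw d) : ℝ :=
  (coreEstimate (lossOf L lam u t ω o) o).trace -
    (U * lossEstimate (W t ω) (lam t ω) (u t ω) (lossOf L lam u t ω o) o).trace

/-- The pathwise regret bound of mirror descent on the estimated losses. -/
lemma IsDenseRun.sum_estimatedGap_le (h : IsDenseRun η T μ ℱ L W lam u D) (hd : 1 ≤ d)
    (hT : 1 ≤ T) (hη : 0 ≤ η) (hη1 : η ≤ 1 / 2) (hL : ∀ t < T, ∀ ω, IsLossMatrix (L t ω))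
    (hpsd : ∀ t < T, ∀ ω, (L t ω).PosSemidef) {v : EuclideanSpace ℝ (Fin d)} (hv : ‖v‖ = 1)
    (ω : Ω) :
    ∑ t ∈ Finset.range T, (η * estimatedGap L W lam u (comparator T v) t ω (D t ω) -
      2 * η ^ 2 * (d : ℝ) ^ 2 * lossOf L lam u t ω (D t ω)) ≤ d * Real.log T := by
  have hd0 : (0 : ℝ) < d := by positivity
  have hT0 : (0 : ℝ) < T := by positivity
  have hUtr := trace_comparator hd hT hv
  obtain ⟨hU, hUdet⟩ := comparator_posDef hd hT hv
  have hstep : ∀ t ∈ Finset.range T,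
      η * estimatedGap L W lam u (comparator T v) t ω (D t ω) -
        2 * η ^ 2 * (d : ℝ) ^ 2 * lossOf L lam u t ω (D t ω) ≤
      potential (comparator T v) (W t ω) - potential (comparator T v) (W (t + 1) ω) := by
    intro t ht
    have ht' := Finset.mem_range.1 ht
    exact update_potential_le (h.eigendecomposition t ht' ω) (h.posDef hd ht'.le ω).1 hη hη1
      (lossOf_nonneg hpsd ht' ω _) (h.lossOf_le_one hd hL ht' ω _) hd _ (h.update t ht' ω) hUtr
  refine (Finset.sum_le_sum hstep).trans ?_
  rw [Finset.sum_range_sub' (fun t => potential (comparator T v) (W t ω)), h.init,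
    potential_uniform hd hUtr]
  -- The initial `-d log d` cancels against `-d log(dT)` from the comparator, leaving `d log T`.
  have := le_potential (h.posDef hd le_rfl ω).1 hU
  rw [Real.log_mul hd0.ne' hT0.ne'] at hUdet
  linarith

/-- The inverses of the density matrices are bounded uniformly over the probability space. -/
lemma IsDenseRun.exists_trace_inv_le (h : IsDenseRun η T μ ℱ L W lam u D) (hd : 1 ≤ d)
    (hη : 0 ≤ η) (hη1 : η ≤ 1 / 2) (hL : ∀ t < T, ∀ ω, IsLossMatrix (L t ω))
    (hpsd : ∀ t < T, ∀ ω, (L t ω).PosSemidef) {t : ℕ} (ht : t ≤ T) :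
    ∃ K : ℝ, ∀ ω, (W t ω)⁻¹.trace ≤ K := by
  induction t with
  | zero =>
    exact ⟨_, fun ω => (congrArg (fun A : Matrix (Fin d) (Fin d) ℝ => A⁻¹.trace) (h.init ω)).le⟩
  | succ t ih =>
    obtain ⟨K, hK⟩ := ih (Nat.le_of_succ_le ht)
    refine ⟨K + η * (2 * d ^ 2 * K) + d * d, fun ω => ?_⟩
    refine (update_trace_inv_le (h.eigendecomposition t ht ω)
      (h.posDef hd (Nat.le_of_succ_le ht) ω).1 hη hη1 (lossOf_nonneg hpsd ht ω _)
      (h.lossOf_le_one hd hL ht ω _) hd _ (h.update t ht ω)).trans ?_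
    have := hK ω
    gcongr

lemma abs_trace_mul_le {A B : Matrix (Fin d) (Fin d) ℝ} {K : ℝ} (hB : ∀ i j, |B i j| ≤ K) :
    |(A * B).trace| ≤ ∑ i, ∑ j, |A i j| * K := by
  simp only [Matrix.trace, Matrix.diag_apply, Matrix.mul_apply]
  refine (Finset.abs_sum_le_sum_abs _ _).trans (Finset.sum_le_sum fun i _ => ?_)
  refine (Finset.abs_sum_le_sum_abs _ _).trans (Finset.sum_le_sum fun j _ => ?_)
  rw [abs_mul]
  exact mul_le_mul_of_nonneg_left (hB j i) (abs_nonneg _)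

lemma IsDenseRun.exists_abs_estimatedGap_le (h : IsDenseRun η T μ ℱ L W lam u D) (hd : 1 ≤ d)
    (hη : 0 ≤ η) (hη1 : η ≤ 1 / 2) (hL : ∀ t < T, ∀ ω, IsLossMatrix (L t ω))
    (hpsd : ∀ t < T, ∀ ω, (L t ω).PosSemidef) (U : Matrix (Fin d) (Fin d) ℝ) {t : ℕ}
    (ht : t < T) : ∃ K : ℝ, ∀ ω o, |estimatedGap L W lam u U t ω o| ≤ K := by
  obtain ⟨K, hK⟩ := h.exists_trace_inv_le hd hη hη1 hL hpsd ht.le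
  refine ⟨∑ _ : Fin d, 2 + ∑ i, ∑ j, |U i j| * (2 * d * K), fun ω o => ?_⟩
  have h0 := lossOf_nonneg (lam := lam) (u := u) hpsd ht ω o
  have h1 := h.lossOf_le_one hd hL ht ω o
  refine (abs_sub _ _).trans (add_le_add ?_ (abs_trace_mul_le fun i j => ?_))
  · exact (Finset.abs_sum_le_sum_abs _ _).trans
      (Finset.sum_le_sum fun i _ => abs_coreEstimate_le h0 h1 o i i)
  · refine (abs_lossEstimate_le (h.eigendecomposition t ht ω) (h.posDef hd ht.le ω).1 h0 h1 o
      i j).trans ?_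
    have := hK ω
    gcongr

end Run

/-! ### Measurability of actions, losses and estimates. -/

section Measurability

variable {α : Type*} [MeasurableSpace α] {d : ℕ} {lam : α → Fin d → ℝ}
  {u : α → OrthonormalBasis (Fin d) ℝ (EuclideanSpace ℝ (Fin d))}
  {L : α → Matrix (Fin d) (Fin d) ℝ}

lemma measurable_action (hlam : ∀ i, Measurable fun a => lam a i)
    (hu : ∀ i j, Measurable fun a => u a i j) (o : Draw d) (j : Fin d) :
    Measurable fun a => action (lam a) (u a) o j := by
  rcases o with i | s
  · exact hu i j
  · simp only [action, WithLp.ofLp_sum, Finset.sum_apply, WithLp.ofLp_smul, Pi.smul_apply,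
      smul_eq_mul]
    exact Finset.measurable_sum _ fun i _ =>
      (measurable_const.mul (hlam i).sqrt).mul (hu i j)

lemma measurable_frob_action (hlam : ∀ i, Measurable fun a => lam a i)
    (hu : ∀ i j, Measurable fun a => u a i j) (hL : ∀ i j, Measurable fun a => L a i j)
    (o : Draw d) : Measurable fun a => frob (outer (action (lam a) (u a) o)) (L a) := by
  simp only [frob_outer, dotProduct_mulVec_eq_sum]
  exact Finset.measurable_sum _ fun i _ => Finset.measurable_sum _ fun j _ =>
    (hL i j).mul ((measurable_action hlam hu o i).mul (measurable_action hlam hu o j))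

lemma measurable_frob_outer (hL : ∀ i j, Measurable fun a => L a i j)
    (v : EuclideanSpace ℝ (Fin d)) : Measurable fun a => frob (outer v) (L a) := by
  simp only [frob_outer, dotProduct_mulVec_eq_sum]
  exact Finset.measurable_sum _ fun i _ => Finset.measurable_sum _ fun j _ =>
    (hL i j).mul_const _

lemma measurable_coreEstimate {ell : α → ℝ} (h : Measurable ell) (o : Draw d) (i j : Fin d) :
    Measurable fun a => coreEstimate (ell a) o i j := by
  rcases o with k | s
  · simp only [coreEstimate, Matrix.smul_apply, smul_eq_mul]
    exact (h.const_mul 2).mul_const _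
  · simp only [coreEstimate, Matrix.smul_apply, smul_eq_mul]
    exact h.mul_const _

lemma measurable_invSqrtFactor (hlam : ∀ i, Measurable fun a => lam a i)
    (hu : ∀ i j, Measurable fun a => u a i j) (i j : Fin d) :
    Measurable fun a => invSqrtFactor (lam a) (u a) i j := by
  simp only [invSqrtFactor, Matrix.mul_diagonal, basisMatrix, Matrix.of_apply]
  exact (hu j i).mul (hlam j).sqrt.inv

/-- In factored form the estimate is a polynomial in measurable coordinates, so no measurability of
matrix inversion is needed. -/
lemma measurable_whitened_estimate (hlam : ∀ i, Measurable fun a => lam a i)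
    (hu : ∀ i j, Measurable fun a => u a i j) {ell : α → ℝ} (h : Measurable ell) (o : Draw d)
    (i j : Fin d) :
    Measurable fun a => (invSqrtFactor (lam a) (u a) * coreEstimate (ell a) o *
      (invSqrtFactor (lam a) (u a))ᵀ) i j := by
  simp only [Matrix.mul_apply, Matrix.transpose_apply]
  exact Finset.measurable_sum _ fun k _ => (Finset.measurable_sum _ fun l _ =>
    (measurable_invSqrtFactor hlam hu i l).mul (measurable_coreEstimate h o l k)).mul
      (measurable_invSqrtFactor hlam hu j k)

end Measurability

/-! ### Averaging over the learner's draw. -/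

section Expectation

variable {Ω : Type*} {mΩ : MeasurableSpace Ω} {d : ℕ}

/-- Averaging over a draw whose conditional law is known. -/
lemma integral_draw {μ : Measure Ω} [IsProbabilityMeasure μ] {m : MeasurableSpace Ω} (hm : m ≤ mΩ)
    {D : Ω → Draw d} (hD : ∀ o, MeasurableSet[mΩ] (D ⁻¹' {o})) {lam : Ω → Fin d → ℝ}
    (hlaw : ∀ o, μ⟦D ⁻¹' {o} | m⟧ =ᵐ[μ] fun ω => drawProb (lam ω) o)
    {F : Ω → Draw d → ℝ} (hF : ∀ o, Measurable[m] fun ω => F ω o) {K : ℝ}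
    (hK : ∀ ω o, |F ω o| ≤ K) :
    Integrable (fun ω => F ω (D ω)) μ ∧
      Integrable (fun ω => ∑ o, drawProb (lam ω) o * F ω o) μ ∧
      ∫ ω, F ω (D ω) ∂μ = ∫ ω, ∑ o, drawProb (lam ω) o * F ω o ∂μ := by
  classical
  have hind : ∀ o, Integrable ((D ⁻¹' {o}).indicator fun _ => (1 : ℝ)) μ := fun o =>
    (integrable_const _).indicator (hD o)
  -- The draw takes finitely many values, so it splits into indicators with coefficients known
  -- before the draw; these can be pulled out of the conditional expectation.
  have hdecomp : (fun ω => F ω (D ω)) =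
      fun ω => ∑ o, (F ω o * (D ⁻¹' {o}).indicator (fun _ => (1 : ℝ)) ω) := by
    ext ω
    rw [Finset.sum_eq_single (D ω)]
    · simp
    · intro o _ ho
      simp [Set.indicator, Ne.symm ho]
    · simp
  have hprod : ∀ o, Integrable
      (fun ω => F ω o * (D ⁻¹' {o}).indicator (fun _ => (1 : ℝ)) ω) μ := fun o =>
    (hind o).bdd_mul (c := K) ((hF o).mono hm le_rfl).aestronglyMeasurable
      (Filter.Eventually.of_forall fun ω => hK ω o)
  have hcond : ∀ o, μ[(fun ω => F ω o) * (D ⁻¹' {o}).indicator (fun _ => (1 : ℝ)) | m] =ᵐ[μ]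
      fun ω => drawProb (lam ω) o * F ω o := by
    intro o
    have h1 := condExp_stronglyMeasurable_mul_of_bound hm (hF o).stronglyMeasurable (hind o) K
      (Filter.Eventually.of_forall fun ω => hK ω o)
    filter_upwards [h1, hlaw o] with ω h1 h2
    rw [h1, Pi.mul_apply, h2, mul_comm]
  -- Integrability comes for free: the function agrees almost everywhere with a conditional
  -- expectation.
  have hmean : ∀ o, Integrable (fun ω => drawProb (lam ω) o * F ω o) μ := fun o =>
    (integrable_congr (hcond o)).1 integrable_condExp
  refine ⟨hdecomp ▸ integrable_finsetSum _ fun o _ => hprod o,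
    integrable_finsetSum _ fun o _ => hmean o, ?_⟩
  rw [hdecomp, integral_finsetSum _ fun o _ => hprod o,
    integral_finsetSum _ fun o _ => hmean o]
  refine Finset.sum_congr rfl fun o _ => ?_
  rw [← integral_congr_ae (hcond o), integral_condExp hm]
  rfl

end Expectation

/-! ### From estimated to true losses, and the regret bound before tuning. -/

section Run

variable {Ω : Type*} {mΩ : MeasurableSpace Ω} {d : ℕ} {η : ℝ} {T : ℕ} {μ : Measure Ω}
  {ℱ : Filtration ℕ mΩ} {L W : ℕ → Ω → Matrix (Fin d) (Fin d) ℝ} {lam : ℕ → Ω → Fin d → ℝ}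
  {u : ℕ → Ω → OrthonormalBasis (Fin d) ℝ (EuclideanSpace ℝ (Fin d))} {D : ℕ → Ω → Draw d}

lemma IsDenseRun.measurable_estimatedGap (h : IsDenseRun η T μ ℱ L W lam u D) (hd : 1 ≤ d)
    (U : Matrix (Fin d) (Fin d) ℝ) {t : ℕ} (ht : t < T) (o : Draw d) :
    Measurable[ℱ t] fun ω => estimatedGap L W lam u U t ω o := by
  have hell : Measurable[ℱ t] fun ω => lossOf L lam u t ω o :=
    @measurable_frob_action Ω (ℱ t) d _ _ _ (h.measurable_eigenvalues t ht)
      (h.measurable_eigenvectors t ht) (h.measurable_loss t ht) o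
  have hcore := @measurable_coreEstimate Ω (ℱ t) d _ hell o
  have hest := @measurable_whitened_estimate Ω (ℱ t) d _ _ (h.measurable_eigenvalues t ht)
      (h.measurable_eigenvectors t ht) _ hell o
  have heq : ∀ ω, lossEstimate (W t ω) (lam t ω) (u t ω) (lossOf L lam u t ω o) o = _ := fun ω =>
    lossEstimate_eq (h.eigendecomposition t ht ω) (h.eigenvalue_pos hd ht ω)
      (lossOf L lam u t ω o) o
  simp only [estimatedGap, heq, Matrix.trace, Matrix.diag_apply,
    Matrix.mul_apply (M := U)]
  refine Measurable.sub (Finset.measurable_sum _ fun i _ => hcore i i)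
    (Finset.measurable_sum _ fun i _ => Finset.measurable_sum _ fun j _ => ?_)
  exact (hest j i).const_mul _

lemma IsDenseRun.sum_drawProb_estimatedGap (h : IsDenseRun η T μ ℱ L W lam u D) (hd : 1 ≤ d)
    (U : Matrix (Fin d) (Fin d) ℝ) {t : ℕ} (ht : t < T) (hL : ∀ ω, IsLossMatrix (L t ω)) (ω : Ω) :
    ∑ o, drawProb (lam t ω) o * estimatedGap L W lam u U t ω o =
      (W t ω * L t ω).trace - (U * L t ω).trace := by
  have heig := h.eigendecomposition t ht ω
  have hlam := h.eigenvalue_pos hd ht ω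
  have hA : ∀ A : Matrix (Fin d) (Fin d) ℝ, (A * L t ω).trace = ∑ o, drawProb (lam t ω) o *
      (A * lossEstimate (W t ω) (lam t ω) (u t ω) (lossOf L lam u t ω o) o).trace := by
    intro A
    conv_lhs => rw [← sum_drawProb_lossEstimate heig hlam (hL ω).1]
    rw [Matrix.mul_sum, Matrix.trace_sum]
    refine Finset.sum_congr rfl fun o _ => ?_
    rw [Matrix.mul_smul, Matrix.trace_smul, smul_eq_mul]
    rfl
  rw [hA, hA, ← Finset.sum_sub_distrib]
  refine Finset.sum_congr rfl fun o _ => ?_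
  rw [estimatedGap, trace_mul_lossEstimate heig hlam]
  ring

lemma IsDenseRun.integral_estimatedGap [IsProbabilityMeasure μ]
    (h : IsDenseRun η T μ ℱ L W lam u D) (hd : 1 ≤ d)
    (hη : 0 ≤ η) (hη1 : η ≤ 1 / 2) (hL : ∀ t < T, ∀ ω, IsLossMatrix (L t ω))
    (hpsd : ∀ t < T, ∀ ω, (L t ω).PosSemidef) (U : Matrix (Fin d) (Fin d) ℝ) {t : ℕ}
    (ht : t < T) :
    Integrable (fun ω => estimatedGap L W lam u U t ω (D t ω)) μ ∧
      Integrable (fun ω => (W t ω * L t ω).trace - (U * L t ω).trace) μ ∧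
      ∫ ω, estimatedGap L W lam u U t ω (D t ω) ∂μ =
        ∫ ω, ((W t ω * L t ω).trace - (U * L t ω).trace) ∂μ := by
  obtain ⟨K, hK⟩ := h.exists_abs_estimatedGap_le hd hη hη1 hL hpsd U ht
  have := integral_draw (ℱ.le t) (fun o => ℱ.le (t + 1) _ (h.measurable_draw t ht o))
    (h.draw_law t ht) (F := fun ω o => estimatedGap L W lam u U t ω o)
    (fun o => h.measurable_estimatedGap hd U ht o) hK
  simpa only [h.sum_drawProb_estimatedGap hd U ht (hL t ht)] using this

lemma IsDenseRun.integral_lossOf [IsProbabilityMeasure μ]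
    (h : IsDenseRun η T μ ℱ L W lam u D) (hd : 1 ≤ d)
    (hL : ∀ t < T, ∀ ω, IsLossMatrix (L t ω))
    (hpsd : ∀ t < T, ∀ ω, (L t ω).PosSemidef) {t : ℕ} (ht : t < T) :
    Integrable (fun ω => lossOf L lam u t ω (D t ω)) μ ∧
      Integrable (fun ω => (W t ω * L t ω).trace) μ ∧
      ∫ ω, lossOf L lam u t ω (D t ω) ∂μ = ∫ ω, (W t ω * L t ω).trace ∂μ := by
  have := integral_draw (ℱ.le t) (fun o => ℱ.le (t + 1) _ (h.measurable_draw t ht o))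
    (h.draw_law t ht) (F := fun ω o => lossOf L lam u t ω o) (K := 1)
    (fun o => @measurable_frob_action Ω (ℱ t) d _ _ _ (h.measurable_eigenvalues t ht)
      (h.measurable_eigenvectors t ht) (h.measurable_loss t ht) o)
    (fun ω o => by
      rw [abs_of_nonneg (lossOf_nonneg hpsd ht ω o)]
      exact h.lossOf_le_one hd hL ht ω o)
  have hsum : ∀ ω, ∑ o, drawProb (lam t ω) o * lossOf L lam u t ω o =
      (W t ω * L t ω).trace := fun ω =>
    sum_drawProb_frob (h.eigendecomposition t ht ω) (h.eigenvalue_pos hd ht ω) (L t ω)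
  simpa only [hsum] using this

lemma IsDenseRun.integrable_frob_outer [IsProbabilityMeasure μ]
    (h : IsDenseRun η T μ ℱ L W lam u D)
    (hL : ∀ t < T, ∀ ω, IsLossMatrix (L t ω)) (hpsd : ∀ t < T, ∀ ω, (L t ω).PosSemidef)
    {v : EuclideanSpace ℝ (Fin d)} (hv : ‖v‖ = 1) {t : ℕ} (ht : t < T) :
    Integrable (fun ω => frob (outer v) (L t ω)) μ := by
  have hmeas := measurable_frob_outer
    (fun i j => (h.measurable_loss t ht i j).mono (ℱ.le t) le_rfl) v
  refine Integrable.of_bound hmeas.aestronglyMeasurable 1 (Filter.Eventually.of_forall fun ω => ?_)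
  rw [Real.norm_eq_abs, abs_of_nonneg (frob_outer_nonneg (hpsd t ht ω) v)]
  exact frob_outer_le (hL t ht ω) hv

/-- The diagonal entries of `A` are at most 1, so `tr A ≤ d` and the uniform part of the comparator
costs at most `1/T` per round. Over `T` rounds the mixing costs 1 in total. -/
lemma trace_comparator_mul_le (hd : 1 ≤ d) (hT : 1 ≤ T) {A : Matrix (Fin d) (Fin d) ℝ}
    (hA : IsLossMatrix A) (hA0 : A.PosSemidef) (v : EuclideanSpace ℝ (Fin d)) :
    (comparator T v * A).trace ≤ 1 / T + frob (outer v) A := by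
  have hd0 : (0 : ℝ) < d := by positivity
  have hT0 : (0 : ℝ) < T := by positivity
  have htr : A.trace ≤ d := by
    calc A.trace ≤ ∑ _ : Fin d, (1 : ℝ) := Finset.sum_le_sum fun i _ => by
          have := frob_outer_le hA (w := EuclideanSpace.single i 1) (by simp)
          rw [frob_outer] at this
          simpa using this
      _ = d := by simp
  have hfrob : (outer v * A).trace = frob (outer v) A := by
    rw [frob, outer_eq_vecMulVec, Matrix.transpose_vecMulVec]
  rw [comparator, Matrix.add_mul, Matrix.smul_mul, Matrix.smul_mul, Matrix.one_mul,
    Matrix.trace_add, Matrix.trace_smul, Matrix.trace_smul, hfrob, smul_eq_mul, smul_eq_mul]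
  have h0 := frob_outer_nonneg hA0 v
  refine add_le_add ?_ ?_
  · calc 1 / (d * T : ℝ) * A.trace ≤ 1 / (d * T : ℝ) * d := by gcongr
      _ = 1 / T := by field_simp
  · have : 0 ≤ 1 / (T : ℝ) := by positivity
    nlinarith

/-- The expected loss of the learner in round `t`. -/
def expectedLoss (μ : Measure Ω) (L : ℕ → Ω → Matrix (Fin d) (Fin d) ℝ)
    (lam : ℕ → Ω → Fin d → ℝ) (u : ℕ → Ω → OrthonormalBasis (Fin d) ℝ (EuclideanSpace ℝ (Fin d)))
    (D : ℕ → Ω → Draw d) (t : ℕ) : ℝ :=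
  ∫ ω, lossOf L lam u t ω (D t ω) ∂μ

lemma IsDenseRun.expectedLoss_sub_le [IsProbabilityMeasure μ]
    (h : IsDenseRun η T μ ℱ L W lam u D) (hd : 1 ≤ d)
    (hT : 1 ≤ T) (hη : 0 ≤ η) (hη1 : η ≤ 1 / 2) (hL : ∀ t < T, ∀ ω, IsLossMatrix (L t ω))
    (hpsd : ∀ t < T, ∀ ω, (L t ω).PosSemidef) {v : EuclideanSpace ℝ (Fin d)} (hv : ‖v‖ = 1)
    {t : ℕ} (ht : t < T) :
    expectedLoss μ L lam u D t - ∫ ω, frob (outer v) (L t ω) ∂μ - 1 / T ≤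
      ∫ ω, estimatedGap L W lam u (comparator T v) t ω (D t ω) ∂μ := by
  obtain ⟨-, hint, heq⟩ := h.integral_estimatedGap hd hη hη1 hL hpsd (comparator T v) ht
  obtain ⟨-, hint', heq'⟩ := h.integral_lossOf hd hL hpsd ht
  have hv' := h.integrable_frob_outer hL hpsd hv ht
  rw [heq, expectedLoss, heq', ← integral_sub hint' hv']
  have hc : (1 / T : ℝ) = ∫ _, (1 / T : ℝ) ∂μ := by simp
  conv_lhs => rw [hc]
  have hint2 : Integrable (fun ω => (W t ω * L t ω).trace - frob (outer v) (L t ω)) μ :=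
    hint'.sub hv'
  rw [← integral_sub hint2 (integrable_const _)]
  refine integral_mono (hint2.sub (integrable_const _)) hint fun ω => ?_
  have := trace_comparator_mul_le hd hT (hL t ht ω) (hpsd t ht ω) v
  simp only
  linarith

/-- The first-order regret bound before tuning. -/
lemma IsDenseRun.mul_regret_le [IsProbabilityMeasure μ]
    (h : IsDenseRun η T μ ℱ L W lam u D) (hd : 1 ≤ d)
    (hT : 1 ≤ T) (hη : 0 ≤ η) (hη1 : η ≤ 1 / 2) (hL : ∀ t < T, ∀ ω, IsLossMatrix (L t ω))
    (hpsd : ∀ t < T, ∀ ω, (L t ω).PosSemidef) {v : EuclideanSpace ℝ (Fin d)} (hv : ‖v‖ = 1) :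
    η * (∑ t ∈ Finset.range T, expectedLoss μ L lam u D t -
        ∫ ω, ∑ t ∈ Finset.range T, frob (outer v) (L t ω) ∂μ) ≤
      η + 2 * η ^ 2 * (d : ℝ) ^ 2 * ∑ t ∈ Finset.range T, expectedLoss μ L lam u D t +
        d * Real.log T := by
  have hT0 : (T : ℝ) ≠ 0 := by positivity
  have hg : ∀ t ∈ Finset.range T, Integrable (fun ω =>
      η * estimatedGap L W lam u (comparator T v) t ω (D t ω) -
      2 * η ^ 2 * (d : ℝ) ^ 2 * lossOf L lam u t ω (D t ω)) μ := fun t ht =>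
    ((h.integral_estimatedGap hd hη hη1 hL hpsd _ (Finset.mem_range.1 ht)).1.const_mul _).sub
      ((h.integral_lossOf hd hL hpsd (Finset.mem_range.1 ht)).1.const_mul _)
  have hpath := integral_mono (integrable_finsetSum _ hg) (integrable_const (d * Real.log T))
    fun ω => h.sum_estimatedGap_le hd hT hη hη1 hL hpsd hv ω
  rw [integral_finsetSum _ hg] at hpath
  simp only [integral_const, probReal_univ, one_smul] at hpath
  refine le_trans ?_ (add_le_add_right hpath
    (η + 2 * η ^ 2 * (d : ℝ) ^ 2 * ∑ t ∈ Finset.range T, expectedLoss μ L lam u D t))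
  rw [integral_finsetSum _ fun t ht =>
    h.integrable_frob_outer hL hpsd hv (Finset.mem_range.1 ht)]
  have hstep : ∀ t ∈ Finset.range T, η * (expectedLoss μ L lam u D t -
      ∫ ω, frob (outer v) (L t ω) ∂μ - 1 / T) -
        2 * η ^ 2 * (d : ℝ) ^ 2 * expectedLoss μ L lam u D t ≤
      ∫ ω, (η * estimatedGap L W lam u (comparator T v) t ω (D t ω) -
      2 * η ^ 2 * (d : ℝ) ^ 2 * lossOf L lam u t ω (D t ω)) ∂μ := by
    intro t ht
    have ht' := Finset.mem_range.1 ht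
    rw [integral_sub
      ((h.integral_estimatedGap hd hη hη1 hL hpsd _ ht').1.const_mul _)
      ((h.integral_lossOf hd hL hpsd ht').1.const_mul _), integral_const_mul, integral_const_mul,
      expectedLoss]
    have := h.expectedLoss_sub_le hd hT hη hη1 hL hpsd hv ht'
    rw [expectedLoss] at this
    gcongr
  have hsum := Finset.sum_le_sum hstep
  rw [Finset.sum_sub_distrib, ← Finset.mul_sum, ← Finset.mul_sum, Finset.sum_sub_distrib,
    Finset.sum_sub_distrib] at hsum
  have h1 : ∑ _ ∈ Finset.range T, (1 / T : ℝ) = 1 := by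
    rw [Finset.sum_const, Finset.card_range, nsmul_eq_mul, mul_one_div_cancel hT0]
  rw [h1] at hsum
  linarith

lemma IsDenseRun.regretAgainst_eq [IsProbabilityMeasure μ]
    (h : IsDenseRun η T μ ℱ L W lam u D) (hd : 1 ≤ d)
    (hL : ∀ t < T, ∀ ω, IsLossMatrix (L t ω)) (hpsd : ∀ t < T, ∀ ω, (L t ω).PosSemidef)
    {v : EuclideanSpace ℝ (Fin d)} (hv : ‖v‖ = 1) :
    regretAgainst T μ L (fun t ω => action (lam t ω) (u t ω) (D t ω)) v =
      ∑ t ∈ Finset.range T, expectedLoss μ L lam u D t -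
        ∫ ω, ∑ t ∈ Finset.range T, frob (outer v) (L t ω) ∂μ := by
  rw [integral_finsetSum _ fun t ht =>
    h.integrable_frob_outer hL hpsd hv (Finset.mem_range.1 ht), ← Finset.sum_sub_distrib,
    regretAgainst]
  refine Finset.sum_congr rfl fun t ht => ?_
  have ht' := Finset.mem_range.1 ht
  rw [expectedLoss, ← integral_sub (h.integral_lossOf hd hL hpsd ht').1
    (h.integrable_frob_outer hL hpsd hv ht')]
  refine integral_congr_ae (Filter.Eventually.of_forall fun ω => ?_)
  simp only [frob, lossOf, Matrix.transpose_sub, Matrix.sub_mul, Matrix.trace_sub]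

lemma bestLoss_nonneg (hpsd : ∀ t < T, ∀ ω, (L t ω).PosSemidef) : 0 ≤ bestLoss T μ L :=
  Real.iInf_nonneg fun _ => integral_nonneg fun ω => Finset.sum_nonneg fun t ht =>
    frob_outer_nonneg (hpsd t (Finset.mem_range.1 ht) ω) _

/-- A self-bounding argument: the regret is controlled by the learner's own loss `E` with
coefficient at most `1/2`, so `E` is first solved for and then substituted back. -/
lemma IsDenseRun.regret_le [IsProbabilityMeasure μ]
    (h : IsDenseRun η T μ ℱ L W lam u D) (hd : 1 ≤ d) (hT : 1 ≤ T)
    (hη : 0 < η) (hη1 : η ≤ 1 / (4 * (d : ℝ) ^ 2)) (hL : ∀ t < T, ∀ ω, IsLossMatrix (L t ω))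
    (hpsd : ∀ t < T, ∀ ω, (L t ω).PosSemidef) {Lbar : ℝ} (hLbar : bestLoss T μ L ≤ Lbar) :
    regret T μ L (fun t ω => action (lam t ω) (u t ω) (D t ω)) ≤
      4 * (η * (d : ℝ) ^ 2 * Lbar) + 2 * (1 + d * Real.log T / η) := by
  have hd1 : (1 : ℝ) ≤ d := by exact_mod_cast hd
  have hηd : η * (d : ℝ) ^ 2 ≤ 1 / 4 := by
    rw [le_div_iff₀ (by positivity)] at hη1
    linarith
  have hη2 : η ≤ 1 / 2 := by nlinarith
  have : Nonempty (Metric.sphere (0 : EuclideanSpace ℝ (Fin d)) 1) :=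
    ⟨⟨EuclideanSpace.single ⟨0, hd⟩ 1, by simp⟩⟩
  set E := ∑ t ∈ Finset.range T, expectedLoss μ L lam u D t with hE
  set A := 1 + d * Real.log T / η with hA
  have hE0 : 0 ≤ E := Finset.sum_nonneg fun t ht => integral_nonneg fun ω =>
    lossOf_nonneg hpsd (Finset.mem_range.1 ht) ω _
  have hbound : ∀ v : Metric.sphere (0 : EuclideanSpace ℝ (Fin d)) 1,
      E - ∫ ω, ∑ t ∈ Finset.range T, frob (outer (v : EuclideanSpace ℝ (Fin d))) (L t ω) ∂μ ≤
        A + 2 * (η * (d : ℝ) ^ 2) * E := by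
    intro v
    have := h.mul_regret_le hd hT hη.le hη2 hL hpsd (mem_sphere_zero_iff_norm.1 v.2)
    refine le_of_mul_le_mul_left (this.trans_eq ?_) hη
    rw [← hE, hA]
    field_simp
    ring
  -- The bound is uniform in `v`, so it passes to the infimum and no minimizer is needed.
  have hbest : E - A - 2 * (η * (d : ℝ) ^ 2) * E ≤ bestLoss T μ L :=
    le_ciInf fun v => by linarith [hbound v]
  have hx0 : 0 ≤ η * (d : ℝ) ^ 2 := by positivity
  have hA0 : 0 ≤ A := by
    have : 0 ≤ Real.log T := Real.log_natCast_nonneg T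
    positivity
  -- Here `1 - 2ηd² ≥ 1/2` is divided out.
  have hE2 : E ≤ 2 * (Lbar + A) := by nlinarith
  refine ciSup_le fun v => ?_
  rw [h.regretAgainst_eq hd hL hpsd (mem_sphere_zero_iff_norm.1 v.2)]
  refine (hbound v).trans ?_
  have h1 := mul_le_mul_of_nonneg_left hE2 hx0
  have h2 := mul_le_mul_of_nonneg_right hηd hA0
  linarith

end Run

/-! ### Tuning of the learning rate. -/

lemma tunedRate_bounds {d T : ℕ} (hd : 1 ≤ d) (hT : 2 ≤ T) {Lbar : ℝ} (hLbar : 0 ≤ Lbar) :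
    0 < tunedRate d T Lbar ∧ tunedRate d T Lbar ≤ 1 / (4 * (d : ℝ) ^ 2) ∧
      tunedRate d T Lbar * (d : ℝ) ^ 2 * Lbar ≤
        (d : ℝ) ^ (3 / 2 : ℝ) * Real.sqrt (Lbar * Real.log T) ∧
      d * Real.log T / tunedRate d T Lbar ≤
        (d : ℝ) ^ (3 / 2 : ℝ) * Real.sqrt (Lbar * Real.log T) + 4 * ((d : ℝ) ^ 3 * Real.log T) := by
  have hd0 : (0 : ℝ) < d := by positivity
  have hl : 0 < Real.log T := Real.log_pos (by exact_mod_cast hT)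
  have hrpow : (d : ℝ) ^ (3 / 2 : ℝ) = d * √d := by
    rw [show (3 / 2 : ℝ) = 1 + 1 / 2 by norm_num, Real.rpow_add hd0, Real.rpow_one,
      Real.sqrt_eq_rpow]
  have hsmall : d * Real.log T / (1 / (4 * (d : ℝ) ^ 2)) = 4 * ((d : ℝ) ^ 3 * Real.log T) := by
    field_simp
  rcases hLbar.eq_or_lt with h0 | hpos
  · subst h0
    simp only [tunedRate, if_true, hsmall]
    refine ⟨by positivity, le_rfl, by simp, by simp⟩
  · rw [tunedRate, if_neg hpos.ne', hrpow, Real.sqrt_mul hLbar, Real.sqrt_div hl.le,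
      Real.sqrt_mul hd0.le]
    set l := Real.log T
    have ha : 0 < √(d : ℝ) := Real.sqrt_pos.2 hd0
    have hb : 0 < √Lbar := Real.sqrt_pos.2 hpos
    have hc : 0 < √l := Real.sqrt_pos.2 hl
    have ha2 : √(d : ℝ) * √(d : ℝ) = d := Real.mul_self_sqrt hd0.le
    have hb2 : √Lbar * √Lbar = Lbar := Real.mul_self_sqrt hLbar
    have hc2 : √l * √l = l := Real.mul_self_sqrt hl.le
    have hr : 0 < √l / (√(d : ℝ) * √Lbar) := by positivity
    refine ⟨lt_min hr (by positivity), min_le_right _ _, ?_, ?_⟩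
    · calc _ ≤ √l / (√(d : ℝ) * √Lbar) * (d : ℝ) ^ 2 * Lbar := by
            gcongr; exact min_le_left _ _
        _ = d * √d * (√Lbar * √l) := by
          -- Applied with `a = √d`, `b = √L̄`, `c = √(log T)`; in these variables the identity is
          -- rational.
          have key : ∀ a b c : ℝ, 0 < a → 0 < b →
              c / (a * b) * (a * a) ^ 2 * (b * b) = a * a * a * (b * c) := by
            intro a b c ha hb
            field_simp
          have := key _ _ √l ha hb
          rwa [ha2, hb2] at this
    · have hlarge : d * l / (√l / (√(d : ℝ) * √Lbar)) = d * √d * (√Lbar * √l) := by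
        field_simp
        linear_combination -hc2
      rcases min_choice (√l / (√(d : ℝ) * √Lbar)) (1 / (4 * (d : ℝ) ^ 2)) with h | h <;> rw [h]
      · rw [hlarge]
        have : 0 ≤ 4 * ((d : ℝ) ^ 3 * l) := by positivity
        linarith
      · rw [hsmall]
        have : 0 ≤ d * √(d : ℝ) * (√Lbar * √l) := by positivity
        linarith

end BanditPCA

end

theorem corollary2 :
    ∃ C : ℝ, 0 < C ∧
      ∀ (d T : ℕ) (_ : 1 ≤ d) (_ : 2 ≤ T)
        (Ω : Type*) (mΩ : MeasurableSpace Ω) (μ : Measure Ω) (_ : IsProbabilityMeasure μ)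
        (ℱ : Filtration ℕ mΩ)
        (L W : ℕ → Ω → Matrix (Fin d) (Fin d) ℝ) (lam : ℕ → Ω → Fin d → ℝ)
        (u : ℕ → Ω → OrthonormalBasis (Fin d) ℝ (EuclideanSpace ℝ (Fin d)))
        (D : ℕ → Ω → BanditPCA.Draw d) (Lbar : ℝ),
        (∀ t < T, ∀ ω, BanditPCA.IsLossMatrix (L t ω)) →
        (∀ t < T, ∀ ω, (L t ω).PosSemidef) →
        BanditPCA.bestLoss T μ L ≤ Lbar →
        BanditPCA.IsDenseRun (BanditPCA.tunedRate d T Lbar) T μ ℱ L W lam u D →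
        BanditPCA.regret T μ L (fun t ω => BanditPCA.action (lam t ω) (u t ω) (D t ω)) ≤
          C * ((d : ℝ) ^ (3 / 2 : ℝ) * Real.sqrt (Lbar * Real.log T)
            + (d : ℝ) ^ 3 * Real.log T) := by
  -- With `X = d^{3/2}√(L̄ log T)` and `Y = d³ log T` the bound is `4X + 2(1 + X + 4Y)`. Since `T ≥
  -- 2` gives `log T ≥ 1/2`, one has `1 ≤ 2Y`, and the total is at most `6X + 12Y`.
  refine ⟨12, by norm_num, ?_⟩
  intro d T hd hT Ω mΩ μ hμ ℱ L W lam u D Lbar hL hpsd hbest hrun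
  have hLbar : 0 ≤ Lbar := (BanditPCA.bestLoss_nonneg hpsd).trans hbest
  obtain ⟨hη0, hη1, h1, h2⟩ := BanditPCA.tunedRate_bounds hd hT hLbar
  refine (hrun.regret_le hd (by omega) hη0 hη1 hL hpsd hbest).trans ?_
  have hd1 : (1 : ℝ) ≤ (d : ℝ) ^ 3 := one_le_pow₀ (by exact_mod_cast hd)
  have hlog : 1 / 2 ≤ Real.log T := by
    have := Real.log_two_gt_d9
    have := Real.log_le_log (by norm_num) (show (2 : ℝ) ≤ T by exact_mod_cast hT)
    linarith
  have h3 : 1 ≤ 2 * ((d : ℝ) ^ 3 * Real.log T) := by nlinarith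
  have h4 : 0 ≤ (d : ℝ) ^ (3 / 2 : ℝ) * Real.sqrt (Lbar * Real.log T) := by positivity
  linarith
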